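/- **Setting.** Let $n\ge 1$. For a finite word $V$ over $\{L,R\}$ let $\sigma(V)$ be the number of its runs (maximal blocks of equal consecutive letters), let $\tau(V)$ be the set of its conjugates (cyclic shifts), and let $\sigma_c(V)=\min\{\sigma(V') : V'\in\tau(V)\}$. A word $V$ is primitive if $V=U^k$ implies $k=1$. Let $\kappa(W)$ be the word obtained from $W$ by replacing every run $Z^i$ ($Z\in\{L,R\}$) by $Z^{i'}$, where $i'\equiv i \pmod n$ and $4n\le i'\le 5n-1$, and put $\tau_\kappa(W)=\tau(\kappa(W'))$, where $W'\in\tau(W)$ and $\sigma(W')=\sigma_c(W)$. Identify $L=\begin{pmatrix}1&0\\1&1\end{pmatrix}$, $R=\begin{pmatrix}1&1\\0&1\end{pmatrix}$, and every word with the product of its letters. Let $\mathcal D_n$ be the set of $2\times 2$ matrices $\begin{pmatrix}a&b\\c&d\end{pmatrix}$ over the nonnegative integers with determinant $n$ and with $\gcd(a,b,c,d)=1$, let $\mathcal{RB}_n\subseteq\mathcal D_n$ be given by $a>c,\ d>b$, and let $\mathcal{DB}_n\subseteq\mathcal{RB}_n$ be given by $a>c,\ d>b,\ a>b,\ d>c$.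 The transducer $\mathcal T_n$ has the set of states $\mathcal{DB}_n$, and it has a transition from $M$ to $N$ with input word $V$ and output word $W$ if and only if $MV=WN$, $MV\notin\mathcal{RB}_n$, and $MV_1\in\mathcal{RB}_n$ for every proper prefix $V_1$ of $V$. A walk is a finite (possibly empty) sequence of consecutive transitions; its input and output words are the concatenations of those of its transitions. Write $M\xrightarrow{V|W}N$ for a walk from $M$ to $N$ with input $V$ and output $W$. Let $\mathcal{LS}_n$ (resp. $\mathcal{RS}_n$) be the set of states $M$ with a walk $M\xrightarrow{L^i|L^j}M$ (resp. $M\xrightarrow{R^i|R^j}M$) for some $i,j>0$. Let $\mathcal{LE}_n$ be the set of those $\begin{pmatrix}a&0\\c&d\end{pmatrix}\in\mathcal{LS}_n$ with $c<\gcd(a,d)$, and $\mathcal{RE}_n$ the set of those $\begin{pmatrix}a&b\\0&d\end{pmatrix}\in\mathcal{RS}_n$ with $b<\gcd(a,d)$. For $M\in\mathcal{LE}_n$ let $\nu_L(M)$ be the least $i>0$ such that a walk $M\xrightarrow{L^i|L^j}M$ exists for some $j$; for $M\in\mathcal{RE}_n$ let $\nu_R(M)$ be the least $i>0$ such that a walk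 $M\xrightarrow{R^i|R^j}M$ exists for some $j$. **Theorem.** For all $M\in\mathcal{LE}_n$ and all $i\in\{\nu_L(M),\dots,2\nu_L(M)-1\}$ there is exactly one triple $(N,j,W)$ such that $N\in\mathcal{RE}_n$, $j\in\{3n-\nu_R(N)+1,\dots,3n\}$ and there is a walk $M\xrightarrow{L^iR^j|W}N$; denote its word $W$ by $W_{L,M,i}$. Moreover, let $\widehat{\mathcal C}_0=\bigl(\widehat M\xrightarrow{\widehat V_0^{\delta}|\widehat W_0}\widehat M\bigr)$ be a closed walk in $\mathcal T_n$ with $\delta\ge1$, $\widehat V_0$ primitive and $\widehat V_0\in\tau_\kappa(\widehat V_0)$, and suppose that $\widehat{\mathcal C}_0\ne\bigl(\widehat M\xrightarrow{\widehat V_0^{\delta_1}|W_1}\widehat M\bigr)^{m_1}$ for all $m_1\ge2$, all $\delta_1\ge1$, all words $W_1$ and all such closed walks at $\widehat M$. Then $$\sigma_c(\widehat W_0)\ \le\ \sigma_c(\widehat V_0)\sum_{M\in\mathcal{LE}_n}\ \sum_{i=\nu_L(M)}^{2\nu_L(M)-1}\bigl(\sigma(W_{L,M,i})-1\bigr).$$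 -/

import Mathlib

namespace Raney

/-- The alphabet `{L, R}`. -/
inductive Letter where
  | L : Letter
  | R : Letter
  deriving DecidableEq

/-- Finite words over `{L, R}`. -/
abbrev Word := List Letter

/-- The word power `V ^ k = V V ⋯ V` (`k` factors). -/
def wpow (V : Word) (k : ℕ) : Word := (List.replicate k V).flatten

/-- A word is primitive if `V = U ^ k` implies `k = 1`. -/
def Primitive (V : Word) : Prop := ∀ (U : Word) (k : ℕ), V = wpow U k → k = 1

/-- The maximal blocks of equal consecutive letters, from left to right. -/
def runs (V : Word) : List Word := V.splitBy (fun x y => decide (x = y))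

/-- `σ(V)`: the number of runs of `V`. -/
def sigma (V : Word) : ℕ := (runs V).length

/-- `τ(V)`: the set of all conjugates (cyclic shifts) of `V`. -/
def tau (V : Word) : Set Word := {W | ∃ V₁ V₂ : Word, V = V₁ ++ V₂ ∧ W = V₂ ++ V₁}

/-- `σ_c(V) = min {σ(V') : V' ∈ τ(V)}` (the set is non-empty, as `V ∈ τ(V)`). -/
noncomputable def sigmaC (V : Word) : ℕ := sInf (sigma '' tau V)

/-- `κ` on one run `Z ^ i`: the result is `Z ^ i'` with `i' ≡ i (mod n)` and
`4 n ≤ i' ≤ 5 n - 1`, that is, `i' = 4 n + (i mod n)`. -/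
def kappaRun (n : ℕ) : Word → Word
  | [] => []
  | x :: r => List.replicate (4 * n + (r.length + 1) % n) x

/-- `κ(W)`: every run is replaced as in `kappaRun`. -/
def kappa (n : ℕ) (W : Word) : Word := ((runs W).map (kappaRun n)).flatten

/-- `τ_κ(W) = τ(κ(W'))`, where `W' ∈ τ(W)` and `σ(W') = σ_c(W)`. -/
def tauKappa (n : ℕ) (W : Word) : Set Word :=
  {V | ∃ W' ∈ tau W, sigma W' = sigmaC W ∧ V ∈ tau (kappa n W')}

/-- `2 × 2` matrices of nonnegative integers; `!![a, b; c, d]` has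
`a = M 0 0`, `b = M 0 1`, `c = M 1 0`, `d = M 1 1`. -/
abbrev Mat := Matrix (Fin 2) (Fin 2) ℕ

/-- `D_n`: determinant `n`, and the gcd of all four entries is `1`. -/
def D (n : ℕ) : Set Mat :=
  {M | (M.map (Nat.cast : ℕ → ℤ)).det = (n : ℤ) ∧
    Nat.gcd (Nat.gcd (M 0 0) (M 0 1)) (Nat.gcd (M 1 0) (M 1 1)) = 1}

/-- Row-balanced matrices. -/
def RB (n : ℕ) : Set Mat := {M | M ∈ D n ∧ M 1 0 < M 0 0 ∧ M 0 1 < M 1 1}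

/-- Column-balanced matrices. -/
def CB (n : ℕ) : Set Mat := {M | M ∈ D n ∧ M 0 1 < M 0 0 ∧ M 1 0 < M 1 1}

/-- Doubly balanced matrices. -/
def DB (n : ℕ) : Set Mat := RB n ∩ CB n

/-- The matrices of the two letters. -/
def Letter.mat : Letter → Mat
  | Letter.L => !![1, 0; 1, 1]
  | Letter.R => !![1, 1; 0, 1]

/-- The matrix `μ(V)` of a word, `μ(VW) = μ(V) μ(W)`. -/
def mu (V : Word) : Mat := (V.map Letter.mat).prod

/-- A (potential) labelled edge: starting state, input word, output word, ending state. -/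
structure Edge where
  src : Mat
  input : Word
  output : Word
  tgt : Mat

/-- The transitions of the transducer `T_n`, whose set of states is `DB n`. -/
def IsTransition (n : ℕ) (e : Edge) : Prop :=
  e.src ∈ DB n ∧ e.tgt ∈ DB n ∧
  e.src * mu e.input = mu e.output * e.tgt ∧
  e.src * mu e.input ∉ RB n ∧
  ∀ V₁ : Word, V₁ <+: e.input → V₁ ≠ e.input → e.src * mu V₁ ∈ RB n

/-- `IsWalk n M p N`: the sequence of edges `p` is a (possibly empty) walk in `T_n`
from the state `M` to the state `N`. -/
def IsWalk (n : ℕ) : Mat → List Edge → Mat → Prop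
  | M, [], N => M ∈ DB n ∧ M = N
  | M, e :: p, N => IsTransition n e ∧ e.src = M ∧ IsWalk n e.tgt p N

/-- The input word of a sequence of edges. -/
def inputWord (p : List Edge) : Word := (p.map Edge.input).flatten

/-- The output word of a sequence of edges. -/
def outputWord (p : List Edge) : Word := (p.map Edge.output).flatten

/-- There is a walk in `T_n` from `M` to `N` with input word `V` and output word `W`. -/
def Walk (n : ℕ) (M : Mat) (V W : Word) (N : Mat) : Prop :=
  ∃ p : List Edge, IsWalk n M p N ∧ inputWord p = V ∧ outputWord p = W

/-- `LS_n`: states with a closed walk that reads `L ^ i` and writes `L ^ j`, `i, j > 0`. -/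
def LS (n : ℕ) : Set Mat :=
  {M | M ∈ DB n ∧ ∃ i j : ℕ, 0 < i ∧ 0 < j ∧
    Walk n M (List.replicate i Letter.L) (List.replicate j Letter.L) M}

/-- `RS_n`: states with a closed walk that reads `R ^ i` and writes `R ^ j`, `i, j > 0`. -/
def RS (n : ℕ) : Set Mat :=
  {M | M ∈ DB n ∧ ∃ i j : ℕ, 0 < i ∧ 0 < j ∧
    Walk n M (List.replicate i Letter.R) (List.replicate j Letter.R) M}

/-- `LE_n`: the matrices `!![a, 0; c, d]` of `LS_n` with `c < gcd(a, d)`. -/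
def LE (n : ℕ) : Set Mat :=
  {M | M ∈ LS n ∧ M 0 1 = 0 ∧ M 1 0 < Nat.gcd (M 0 0) (M 1 1)}

/-- `RE_n`: the matrices `!![a, b; 0, d]` of `RS_n` with `b < gcd(a, d)`. -/
def RE (n : ℕ) : Set Mat :=
  {M | M ∈ RS n ∧ M 1 0 = 0 ∧ M 0 1 < Nat.gcd (M 0 0) (M 1 1)}

/-- `ν_L(M)`, the least `i > 0` such that some closed walk at `M` reads `L ^ i` and writes a power
of `L`; such an `i` exists for all `M ∈ LS n`. -/
noncomputable def nuL (n : ℕ) (M : Mat) : ℕ :=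
  sInf {i | 0 < i ∧ ∃ j : ℕ,
    Walk n M (List.replicate i Letter.L) (List.replicate j Letter.L) M}

/-- `ν_R(M)`, the least `i > 0` such that some closed walk at `M` reads `R ^ i` and writes a power
of `R`; such an `i` exists for all `M ∈ RS n`. -/
noncomputable def nuR (n : ℕ) (M : Mat) : ℕ :=
  sInf {i | 0 < i ∧ ∃ j : ℕ,
    Walk n M (List.replicate i Letter.R) (List.replicate j Letter.R) M}

/-- The properties that determine `N_{L,M,i}`, `j_{L,M,i}` and `W_{L,M,i}`:
`N ∈ RE_n`, `j ∈ {3n - ν_R(N) + 1, …, 3n}`, and `W` is the output word of a walk from `M` to `N`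
with input word `L ^ i R ^ j`. -/
def IsLRData (n : ℕ) (M : Mat) (i : ℕ) (N : Mat) (j : ℕ) (W : Word) : Prop :=
  N ∈ RE n ∧ 3 * n < j + nuR n N ∧ j ≤ 3 * n ∧
  Walk n M (List.replicate i Letter.L ++ List.replicate j Letter.R) W N

open Classical in
/-- The word `W_{L,M,i}`. -/
noncomputable def wordL (n : ℕ) (M : Mat) (i : ℕ) : Word :=
  if h : ∃ W : Word, ∃ (N : Mat) (j : ℕ), IsLRData n M i N j W then h.choose else []

/-- `DB n` is finite, since all the entries of its elements are at most `n`. -/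
theorem DB_finite (n : ℕ) : (DB n).Finite := by
  have hfin : {M : Mat | ∀ i j, M i j ∈ Set.Iic n}.Finite := by
    have h := Set.Finite.pi' (ι := Fin 2) (κ := fun _ => Fin 2 → ℕ)
      (t := fun _ => {v | ∀ j, v j ∈ Set.Iic n})
      (fun _ => Set.Finite.pi' (fun _ => Set.finite_Iic n))
    exact h
  refine hfin.subset ?_
  rintro M ⟨⟨⟨hdet, -⟩, h1, h2⟩, -, h3, h4⟩
  rw [Matrix.det_fin_two] at hdet
  simp only [Matrix.map_apply] at hdet
  have h1' : (M 1 0 : ℤ) + 1 ≤ M 0 0 := by exact_mod_cast h1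
  have h2' : (M 0 1 : ℤ) + 1 ≤ M 1 1 := by exact_mod_cast h2
  have hb : (0 : ℤ) ≤ M 0 1 := by positivity
  have hc : (0 : ℤ) ≤ M 1 0 := by positivity
  have hs : (M 0 0 : ℤ) + M 1 1 - 1 ≤ n := by
    nlinarith [mul_nonneg hb (sub_nonneg.2 h1'), mul_nonneg hc (sub_nonneg.2 h2'),
      mul_nonneg (sub_nonneg.2 h1') (sub_nonneg.2 h2')]
  have ha : M 0 0 ≤ n := by omega
  have hd : M 1 1 ≤ n := by omega
  intro i j
  fin_cases i <;> fin_cases j <;> simp only [Set.mem_Iic] <;> simp <;> omega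

/-- `LE n` is finite. -/
theorem LE_finite (n : ℕ) : (LE n).Finite :=
  (DB_finite n).subset fun _ hM => hM.1.1

end Raney

/-!
Everything about the transducer is read off from matrix identities. Every matrix `P` of `D n` is in
a unique way a product `μ(W) N` of a word and a row-balanced matrix (`exists_reduction`,
`reduction_unique`); write `N = nf n P` and `W = out n P`. Between doubly balanced matrices the
walks with input `V` and output `W` are exactly the identities `M V = W N` (`walk_iff`), and a walk
is determined by its first state and its input (`isWalk_unique`). A walk can thus be followed
letter by letter through row-balanced matrices.

The elements of `LE n` and `RE n` are the lower and upper triangular matrices of `D n` whose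
off-diagonal entry is less than the gcd of the diagonal ones, and `ν_L`, `ν_R` are a diagonal entry
divided by this gcd. The Euclidean algorithm on the first column of any `P ∈ D n` shows that
`P R ^ j = W N` for some `N ∈ RE n` and some `j` in the window `(3 n - ν_R(N), 3 n]`, with `W` ending
with `R` (`exists_mem_RE`). Two solutions have the same `N`, because the upper right entry is
determined modulo the gcd, and hence the same `j`, because the times at which `N` recurs differ by
multiples of `ν_R(N)` (`mem_RE_window_unique`). With `P = M L ^ i` this defines `W_{L,M,i}`.

For the estimate, let `Q` be the row-balanced matrix present at the end of a long run of `L`s; it is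
lower triangular. When a long run of `R`s follows, the number of changes of letters in the output
(counted with the preceding `L`) depends on `Q` only: it is `weight n L Q`. Moreover
`M L ^ i = L ^ s Q` with `s > 0` for some `M ∈ LE n` and `ν_L(M) ≤ i < 2 ν_L(M)`
(`exists_cut`), so this weight equals `σ(W_{L,M,i}) - 1`, and distinct matrices `Q` give distinct
pairs `(M, i)`. Consequently the weights of pairwise distinct matrices sum up to at most
`totalWeight n`, the double sum of the theorem (`sum_weight_L_le`). Exchanging `L` and `R` gives
the same bound for the ends of runs of `R`s.

A primitive word `V₀ ∈ τ_κ(V₀)` is conjugate to an alternating word with at most `σ_c(V₀)` runs, all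
of them long (`exists_blocks_of_mem_tauKappa`). Since the closed walk is not a power of a shorter
one, the matrices found at the start of its `δ` copies of `V₀` are distinct
(`minimalPeriod_of_walk`), and since reading is deterministic, so are the `δ` matrices found at the
end of any given run of `V₀`. So each run contributes at most `totalWeight n` to the number of
changes of letters in the cyclic output word (`sum_cost_le`, `sigmaC_out_le`).
-/

namespace Raney

/-! ### Matrices of words and row reduction -/

theorem mu_nil : mu [] = 1 := rfl

theorem mu_cons (Z : Letter) (V : Word) : mu (Z :: V) = Z.mat * mu V := by
  simp [mu]

theorem mu_append (V W : Word) : mu (V ++ W) = mu V * mu W := by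
  simp [mu]

theorem mu_replicate_L (i : ℕ) : mu (List.replicate i Letter.L) = !![1, 0; i, 1] := by
  induction i with
  | zero => simp [mu_nil, Matrix.one_fin_two]
  | succ k ih =>
    rw [List.replicate_succ, mu_cons, ih]
    simp [Letter.mat, add_comm]

theorem mu_replicate_R (i : ℕ) : mu (List.replicate i Letter.R) = !![1, i; 0, 1] := by
  induction i with
  | zero => simp [mu_nil, Matrix.one_fin_two]
  | succ k ih =>
    rw [List.replicate_succ, mu_cons, ih]
    simp [Letter.mat]

theorem gcd_four_eq_one_iff (a b c d : ℕ) :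
    Nat.gcd (Nat.gcd a b) (Nat.gcd c d) = 1 ↔
      ∀ k, k ∣ a → k ∣ b → k ∣ c → k ∣ d → k = 1 := by
  constructor
  · intro h k ha hb hc hd
    have := Nat.dvd_gcd (Nat.dvd_gcd ha hb) (Nat.dvd_gcd hc hd)
    rw [h] at this
    exact Nat.dvd_one.1 this
  · intro h
    apply h
    · exact (Nat.gcd_dvd_left _ _).trans (Nat.gcd_dvd_left _ _)
    · exact (Nat.gcd_dvd_left _ _).trans (Nat.gcd_dvd_right _ _)
    · exact (Nat.gcd_dvd_right _ _).trans (Nat.gcd_dvd_left _ _)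
    · exact (Nat.gcd_dvd_right _ _).trans (Nat.gcd_dvd_right _ _)

theorem mem_D_iff {n : ℕ} {M : Mat} :
    M ∈ D n ↔ M 0 0 * M 1 1 = n + M 0 1 * M 1 0 ∧
      ∀ k, k ∣ M 0 0 → k ∣ M 0 1 → k ∣ M 1 0 → k ∣ M 1 1 → k = 1 := by
  rw [← gcd_four_eq_one_iff]
  simp only [D, Set.mem_ofPred_eq, Matrix.det_fin_two, Matrix.map_apply]
  refine and_congr_left fun _ => ?_
  constructor
  · intro h; zify; linarith
  · intro h; zify at h; linarith

theorem mem_D_mk {n a b c d : ℕ} :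
    !![a, b; c, d] ∈ D n ↔ a * d = n + b * c ∧
      ∀ k, k ∣ a → k ∣ b → k ∣ c → k ∣ d → k = 1 := by
  simp [mem_D_iff]

theorem mem_RB_mk {n a b c d : ℕ} :
    !![a, b; c, d] ∈ RB n ↔ !![a, b; c, d] ∈ D n ∧ c < a ∧ b < d := by
  simp [RB]; tauto

theorem mem_DB_mk {n a b c d : ℕ} :
    !![a, b; c, d] ∈ DB n ↔ !![a, b; c, d] ∈ D n ∧ (c < a ∧ b < d) ∧ b < a ∧ c < d := by
  simp only [DB, RB, CB, Set.mem_inter_iff, Set.mem_ofPred_eq]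
  simp
  tauto

/-- Every `2 × 2` matrix is given by its entries. -/
theorem exists_entries (M : Mat) : ∃ a b c d, M = !![a, b; c, d] :=
  ⟨_, _, _, _, Matrix.eta_fin_two M⟩

theorem mat_mul_mem_D (n : ℕ) (Z : Letter) (M : Mat) : Z.mat * M ∈ D n ↔ M ∈ D n := by
  obtain ⟨a, b, c, d, rfl⟩ := exists_entries M
  cases Z
  · simp only [Letter.mat, Matrix.mul_fin_two, mem_D_mk]
    refine and_congr ?_ (forall_congr' fun k => ?_)
    · constructor <;> intro h <;> nlinarith
    · simp only [one_mul, zero_mul, add_zero]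
      constructor
      · intro h h1 h2 h3 h4
        exact h h1 h2 (dvd_add h1 h3) (dvd_add h2 h4)
      · intro h h1 h2 h3 h4
        exact h h1 h2 ((Nat.dvd_add_right h1).1 h3) ((Nat.dvd_add_right h2).1 h4)
  · simp only [Letter.mat, Matrix.mul_fin_two, mem_D_mk]
    refine and_congr ?_ (forall_congr' fun k => ?_)
    · constructor <;> intro h <;> nlinarith
    · simp only [one_mul, zero_mul, zero_add]
      constructor
      · intro h h1 h2 h3 h4
        exact h (dvd_add h1 h3) (dvd_add h2 h4) h3 h4
      · intro h h1 h2 h3 h4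
        exact h ((Nat.dvd_add_left h3).1 h1) ((Nat.dvd_add_left h4).1 h2) h3 h4

theorem mul_mat_mem_D (n : ℕ) (Z : Letter) (M : Mat) : M * Z.mat ∈ D n ↔ M ∈ D n := by
  obtain ⟨a, b, c, d, rfl⟩ := exists_entries M
  cases Z
  · simp only [Letter.mat, Matrix.mul_fin_two, mem_D_mk]
    refine and_congr ?_ (forall_congr' fun k => ?_)
    · constructor <;> intro h <;> nlinarith
    · simp only [mul_one, mul_zero, zero_add]
      constructor
      · intro h h1 h2 h3 h4
        exact h (dvd_add h1 h2) h2 (dvd_add h3 h4) h4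
      · intro h h1 h2 h3 h4
        exact h ((Nat.dvd_add_left h2).1 h1) h2 ((Nat.dvd_add_left h4).1 h3) h4
  · simp only [Letter.mat, Matrix.mul_fin_two, mem_D_mk]
    refine and_congr ?_ (forall_congr' fun k => ?_)
    · constructor <;> intro h <;> nlinarith
    · simp only [mul_one, mul_zero, add_zero]
      constructor
      · intro h h1 h2 h3 h4
        exact h h1 (dvd_add h1 h2) h3 (dvd_add h3 h4)
      · intro h h1 h2 h3 h4
        exact h h1 ((Nat.dvd_add_right h1).1 h2) h3 ((Nat.dvd_add_right h3).1 h4)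

theorem mu_mul_mem_D (n : ℕ) (W : Word) (M : Mat) : mu W * M ∈ D n ↔ M ∈ D n := by
  induction W with
  | nil => simp [mu_nil]
  | cons Z W ih => rw [mu_cons, mul_assoc, mat_mul_mem_D, ih]

theorem mul_mu_mem_D (n : ℕ) (W : Word) (M : Mat) : M * mu W ∈ D n ↔ M ∈ D n := by
  induction W generalizing M with
  | nil => simp [mu_nil]
  | cons Z W ih => rw [mu_cons, ← mul_assoc, ih, mul_mat_mem_D]

theorem pos_of_mem_D {n : ℕ} (hn : 0 < n) {M : Mat} (hM : M ∈ D n) : 0 < M 0 0 ∧ 0 < M 1 1 := by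
  have h := (mem_D_iff.1 hM).1
  exact ⟨Nat.pos_of_mul_pos_right (b := M 1 1) (by omega),
    Nat.pos_of_mul_pos_left (a := M 0 0) (by omega)⟩

/-- Every matrix of `D n` is the product of a word and a row-balanced matrix: as long as one row
dominates the other, subtract. -/
theorem exists_reduction {n : ℕ} (hn : 0 < n) (P : Mat) (hP : P ∈ D n) :
    ∃ (W : Word) (N : Mat), N ∈ RB n ∧ P = mu W * N := by
  induction hs : P 0 0 + P 0 1 + P 1 0 + P 1 1 using Nat.strong_induction_on generalizing P with
  | _ s ih =>
  by_cases hR : P ∈ RB n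
  · exact ⟨[], P, hR, by simp [mu_nil]⟩
  have hpos := pos_of_mem_D hn hP
  obtain ⟨hdet, -⟩ := mem_D_iff.1 hP
  have hR' : P 0 0 ≤ P 1 0 ∨ P 1 1 ≤ P 0 1 := by
    by_contra! h
    exact hR ⟨hP, h.1, h.2⟩
  obtain ⟨a, b, c, d, rfl⟩ := exists_entries P
  simp at hdet hR' hpos hs
  rcases hR' with h | h
  · obtain ⟨c, rfl⟩ := Nat.exists_eq_add_of_le h
    have hbd : b ≤ d := by
      by_contra! h'
      nlinarith
    obtain ⟨d, rfl⟩ := Nat.exists_eq_add_of_le hbd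
    have he : !![a, b; a + c, b + d] = Letter.L.mat * !![a, b; c, d] := by
      simp [Letter.mat]
    rw [he, mat_mul_mem_D] at hP
    obtain ⟨W, N, hN, hW⟩ := ih (a + b + c + d) (by omega) _ hP (by simp)
    exact ⟨Letter.L :: W, N, hN, by rw [he, hW, mu_cons, mul_assoc]⟩
  · obtain ⟨b, rfl⟩ := Nat.exists_eq_add_of_le' h
    have hbd : c ≤ a := by
      by_contra! h'
      nlinarith
    obtain ⟨a, rfl⟩ := Nat.exists_eq_add_of_le' hbd
    have he : !![a + c, b + d; c, d] = Letter.R.mat * !![a, b; c, d] := by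
      simp [Letter.mat]
    rw [he, mat_mul_mem_D] at hP
    obtain ⟨W, N, hN, hW⟩ := ih (a + b + c + d) (by omega) _ hP (by simp)
    exact ⟨Letter.R :: W, N, hN, by rw [he, hW, mu_cons, mul_assoc]⟩

theorem mat_mul_cancel {Z : Letter} {X Y : Mat} (h : Z.mat * X = Z.mat * Y) : X = Y := by
  obtain ⟨a, b, c, d, rfl⟩ := exists_entries X
  obtain ⟨a', b', c', d', rfl⟩ := exists_entries Y
  cases Z <;> simp [Letter.mat] at h ⊢ <;> omega

theorem mat_mul_notMem_RB (n : ℕ) (Z : Letter) (X : Mat) : Z.mat * X ∉ RB n := by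
  obtain ⟨a, b, c, d, rfl⟩ := exists_entries X
  cases Z <;> simp [Letter.mat, mem_RB_mk]

theorem L_mul_ne_R_mul {n : ℕ} (hn : 0 < n) {X Y : Mat} (hX : X ∈ D n) :
    Letter.L.mat * X ≠ Letter.R.mat * Y := by
  intro h
  have := pos_of_mem_D hn hX
  obtain ⟨a, b, c, d, rfl⟩ := exists_entries X
  obtain ⟨a', b', c', d', rfl⟩ := exists_entries Y
  simp [Letter.mat] at h this
  omega

/-- The factorization into a word and a row-balanced matrix is unique. -/
theorem reduction_unique {n : ℕ} (hn : 0 < n) {W W' : Word} {N N' : Mat} (hN : N ∈ RB n)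
    (hN' : N' ∈ RB n) (h : mu W * N = mu W' * N') : W = W' ∧ N = N' := by
  induction W generalizing W' with
  | nil =>
    cases W' with
    | nil => simpa [mu_nil] using h
    | cons Z W' =>
      rw [mu_nil, one_mul, mu_cons, mul_assoc] at h
      exact absurd (h ▸ hN) (mat_mul_notMem_RB n Z _)
  | cons Z W ih =>
    cases W' with
    | nil =>
      rw [mu_nil, one_mul, mu_cons, mul_assoc] at h
      exact absurd (h ▸ hN') (mat_mul_notMem_RB n Z _)
    | cons Z' W' =>
      rw [mu_cons, mu_cons, mul_assoc, mul_assoc] at h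
      have hD : mu W * N ∈ D n := (mu_mul_mem_D n W N).2 hN.1
      have hD' : mu W' * N' ∈ D n := (mu_mul_mem_D n W' N').2 hN'.1
      have hZ : Z = Z' := by
        cases Z <;> cases Z'
        · rfl
        · exact absurd h (L_mul_ne_R_mul hn hD)
        · exact absurd h.symm (L_mul_ne_R_mul hn hD')
        · rfl
      subst hZ
      obtain ⟨h1, h2⟩ := ih (mat_mul_cancel h)
      exact ⟨by rw [h1], h2⟩

/-! ### Walks as matrix identities -/

theorem isWalk_src {n : ℕ} {M N : Mat} {p : List Edge} (h : IsWalk n M p N) : M ∈ DB n := by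
  cases p with
  | nil => exact h.1
  | cons e p => exact h.2.1 ▸ h.1.1

theorem isWalk_tgt {n : ℕ} {M N : Mat} {p : List Edge} (h : IsWalk n M p N) : N ∈ DB n := by
  induction p generalizing M with
  | nil => exact h.2 ▸ h.1
  | cons e p ih => exact ih h.2.2

theorem isWalk_mul_mu {n : ℕ} {M N : Mat} {p : List Edge} (h : IsWalk n M p N) :
    M * mu (inputWord p) = mu (outputWord p) * N := by
  induction p generalizing M with
  | nil => simp [inputWord, outputWord, mu_nil, h.2]
  | cons e p ih =>
    obtain ⟨h1, rfl, h3⟩ := h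
    have := ih h3
    simp only [inputWord, outputWord, List.map_cons, List.flatten_cons, mu_append] at this ⊢
    rw [← mul_assoc, h1.2.2.1, mul_assoc, this, mul_assoc]

theorem isWalk_append {n : ℕ} {M N K : Mat} {p q : List Edge} (hp : IsWalk n M p N)
    (hq : IsWalk n N q K) : IsWalk n M (p ++ q) K := by
  induction p generalizing M with
  | nil => exact hp.2 ▸ hq
  | cons e p ih => exact ⟨hp.1, hp.2.1, ih hp.2.2⟩

/-- Row subtractions preserve column balance: applied to the difference of the two columns, they
keep its sign pattern `(+, -)`. -/
theorem balanced_of_mu_mul (W : Word) (N : Mat)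
    (h : (mu W * N) 0 1 < (mu W * N) 0 0 ∧ (mu W * N) 1 0 < (mu W * N) 1 1) :
    N 0 1 < N 0 0 ∧ N 1 0 < N 1 1 := by
  induction W with
  | nil => simpa [mu_nil] using h
  | cons Z W ih =>
    apply ih
    rw [mu_cons, mul_assoc] at h
    generalize mu W * N = X at h ⊢
    obtain ⟨a, b, c, d, rfl⟩ := exists_entries X
    cases Z <;> simp [Letter.mat] at h ⊢ <;> omega

/-- Raney's observation: when the letter `Z` makes a row-balanced matrix unbalanced, the
row-balanced part of the product is doubly balanced. -/
theorem mem_CB_of_mul_mat {n : ℕ} {P N : Mat} {Z : Letter} {W : Word} (hP : P ∈ RB n)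
    (hN : N ∈ RB n) (hPZ : P * Z.mat ∉ RB n) (h : P * Z.mat = mu W * N) : N ∈ CB n := by
  refine ⟨hN.1, ?_⟩
  have hD : P * Z.mat ∈ D n := (mul_mat_mem_D n Z P).2 hP.1
  cases W with
  | nil => rw [h, mu_nil, one_mul] at hPZ; exact absurd hN hPZ
  | cons Y W =>
    apply balanced_of_mu_mul W N
    rw [mu_cons, mul_assoc] at h
    generalize mu W * N = X at h ⊢
    obtain ⟨a, b, c, d, rfl⟩ := exists_entries P
    obtain ⟨a', b', c', d', rfl⟩ := exists_entries X
    have := (mem_RB_mk.1 hP).2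
    cases Z <;> cases Y <;> simp [Letter.mat] at h ⊢ <;> omega

theorem mul_mu_notMem_CB (n : ℕ) (X : Mat) {V : Word} (hV : V ≠ []) : X * mu V ∉ CB n := by
  obtain ⟨V, Z, rfl⟩ := (List.eq_nil_or_concat V).resolve_left hV
  rw [List.concat_eq_append, mu_append, ← mul_assoc, mu_cons, mu_nil, mul_one]
  rintro ⟨-, h⟩
  generalize X * mu V = Y at h
  obtain ⟨a, b, c, d, rfl⟩ := exists_entries Y
  cases Z <;> simp [Letter.mat] at h

/-- Walks of the transducer are the factorizations `M V = W N` between doubly balanced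
matrices. -/
theorem walk_iff {n : ℕ} (hn : 0 < n) {M N : Mat} {V W : Word} :
    Walk n M V W N ↔ M ∈ DB n ∧ N ∈ DB n ∧ M * mu V = mu W * N := by
  constructor
  · rintro ⟨p, hp, rfl, rfl⟩
    exact ⟨isWalk_src hp, isWalk_tgt hp, isWalk_mul_mu hp⟩
  rintro ⟨hM, hN, h⟩
  induction hl : V.length using Nat.strong_induction_on generalizing M V W with
  | _ l ih =>
  by_cases hV : V = []
  · subst hV
    rw [mu_nil, mul_one] at h
    obtain ⟨h1, h2⟩ := reduction_unique hn (W := []) (W' := W) hM.1 hN.1 (by rw [mu_nil, one_mul, h])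
    subst h1 h2
    exact ⟨[], ⟨hM, rfl⟩, rfl, rfl⟩
  have hMV : M * mu V ∉ RB n := by
    intro hR
    obtain ⟨-, h2⟩ := reduction_unique hn (W := []) (W' := W) hR hN.1 (by rw [mu_nil, one_mul, h])
    exact mul_mu_notMem_CB n M hV (h2 ▸ hN.2)
  have hex : ∃ k, M * mu (V.take k) ∉ RB n := ⟨V.length, by rwa [List.take_length]⟩
  classical
  set k := Nat.find hex with hk
  have hk1 : M * mu (V.take k) ∉ RB n := Nat.find_spec hex
  have hmin : ∀ V₁ : Word, V₁ <+: V.take k → V₁ ≠ V.take k → M * mu V₁ ∈ RB n := by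
    intro V₁ h1 h2
    have hlt : V₁.length < (V.take k).length :=
      lt_of_le_of_ne h1.length_le fun he => h2 (h1.eq_of_length he)
    rw [List.length_take] at hlt
    have := Nat.find_min hex (m := V₁.length) (by omega)
    rw [not_not] at this
    rwa [List.prefix_iff_eq_take.1 (h1.trans (List.take_prefix k V))]
  have hne : V.take k ≠ [] := by
    intro h0
    rw [h0, mu_nil, mul_one] at hk1
    exact hk1 hM.1
  obtain ⟨V', Z, hV'⟩ := (List.eq_nil_or_concat (V.take k)).resolve_left hne
  rw [List.concat_eq_append] at hV'
  have hP : M * mu V' ∈ RB n := by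
    apply hmin
    · rw [hV']; exact List.prefix_append _ _
    · rw [hV']; simp
  obtain ⟨W₁, N₁, hN₁, hW₁⟩ := exists_reduction hn (M * mu (V.take k))
    ((mul_mu_mem_D n _ _).2 hM.1.1)
  have hstep : M * mu (V.take k) = M * mu V' * Z.mat := by
    rw [hV', mu_append, mul_assoc, mu_cons, mu_nil, mul_one]
  have hN₁' : N₁ ∈ DB n :=
    ⟨hN₁, mem_CB_of_mul_mat hP hN₁ (hstep ▸ hk1) (hstep ▸ hW₁)⟩
  obtain ⟨W₂, N₂, hN₂, hW₂⟩ := exists_reduction hn (N₁ * mu (V.drop k))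
    ((mul_mu_mem_D n _ _).2 hN₁'.1.1)
  have hall : mu W * N = mu (W₁ ++ W₂) * N₂ := by
    rw [← h, mu_append, mul_assoc, ← hW₂, ← mul_assoc, ← hW₁, mul_assoc, ← mu_append,
      List.take_append_drop]
  obtain ⟨rfl, rfl⟩ := reduction_unique hn hN.1 hN₂ hall
  have hk0 : 0 < (V.take k).length := List.length_pos_iff.2 hne
  obtain ⟨p, hp, hp1, hp2⟩ := ih (V.drop k).length
    (by rw [List.length_take] at hk0; rw [List.length_drop]; omega) hN₁' hW₂ rfl
  refine ⟨⟨M, V.take k, W₁, N₁⟩ :: p, ⟨⟨hM, hN₁', hW₁, hk1, hmin⟩, rfl, hp⟩, ?_, ?_⟩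
  · rw [inputWord] at hp1 ⊢
    simp [hp1]
  · rw [outputWord] at hp2 ⊢
    simp [hp2]

theorem IsTransition.input_ne_nil {n : ℕ} {e : Edge} (h : IsTransition n e) : e.input ≠ [] := by
  intro h0
  have := h.2.2.2.1
  rw [h0, mu_nil, mul_one] at this
  exact this h.1.1

theorem IsTransition.eq_of_prefix {n : ℕ} {e e' : Edge} (h : IsTransition n e)
    (h' : IsTransition n e') (hs : e.src = e'.src) (hp : e.input <+: e'.input) :
    e.input = e'.input := by
  by_contra hne
  exact h.2.2.2.1 (hs ▸ h'.2.2.2.2 _ hp hne)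

/-- The transducer is deterministic: a walk is determined by its first state and its input. -/
theorem isWalk_unique {n : ℕ} (hn : 0 < n) {M N N' : Mat} {p p' : List Edge}
    (h : IsWalk n M p N) (h' : IsWalk n M p' N') (hi : inputWord p = inputWord p') : p = p' := by
  induction p generalizing M p' with
  | nil =>
    cases p' with
    | nil => rfl
    | cons e' p' =>
      simp [inputWord] at hi
      exact absurd hi.1 h'.1.input_ne_nil
  | cons e p ih =>
    cases p' with
    | nil =>
      simp [inputWord] at hi
      exact absurd hi.1 h.1.input_ne_nil
    | cons e' p' =>
      have hs : e.src = e'.src := h.2.1.trans h'.2.1.symm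
      rw [inputWord, inputWord, List.map_cons, List.map_cons, List.flatten_cons,
        List.flatten_cons] at hi
      have hin : e.input = e'.input := by
        rcases List.prefix_or_prefix_of_prefix (List.prefix_append e.input _)
          (hi ▸ List.prefix_append e'.input _) with h1 | h1
        · exact h.1.eq_of_prefix h'.1 hs h1
        · exact (h'.1.eq_of_prefix h.1 hs.symm h1).symm
      have ho := reduction_unique hn h.1.2.1.1 h'.1.2.1.1
        (by rw [← h.1.2.2.1, ← h'.1.2.2.1, hs, hin])
      have hee : e = e' := by
        cases e; cases e'
        simp only [Edge.mk.injEq]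
        exact ⟨hs, hin, ho⟩
      subst hee
      rw [ih h.2.2 h'.2.2 (List.append_cancel_left hi)]

/-! ### The states of `LE n` and `RE n`, and the words `W_{L,M,i}` -/

theorem mul_replicate_L (a b c d i : ℕ) :
    !![a, b; c, d] * mu (List.replicate i Letter.L) = !![a + b * i, b; c + d * i, d] := by
  simp [mu_replicate_L]

theorem mul_replicate_R (a b c d i : ℕ) :
    !![a, b; c, d] * mu (List.replicate i Letter.R) = !![a, a * i + b; c, c * i + d] := by
  simp [mu_replicate_R]

theorem replicate_L_mul (a b c d i : ℕ) :
    mu (List.replicate i Letter.L) * !![a, b; c, d] = !![a, b; i * a + c, i * b + d] := by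
  simp [mu_replicate_L]

theorem replicate_R_mul (a b c d i : ℕ) :
    mu (List.replicate i Letter.R) * !![a, b; c, d] = !![a + i * c, b + i * d; c, d] := by
  simp [mu_replicate_R]

theorem dvd_mul_iff_div_gcd_dvd {a d : ℕ} (hd : 0 < d) (i : ℕ) :
    d ∣ a * i ↔ d / Nat.gcd a d ∣ i := by
  obtain ⟨a', d', hc, ha, hd'⟩ := Nat.exists_coprime a d
  have hg : 0 < Nat.gcd a d := Nat.gcd_pos_of_pos_right _ hd
  generalize Nat.gcd a d = g at *
  subst ha hd'
  rw [Nat.mul_div_cancel _ hg, mul_right_comm, Nat.mul_dvd_mul_iff_right hg]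
  exact hc.symm.dvd_mul_left

theorem isLeast_div_gcd {a d : ℕ} (hd : 0 < d) :
    IsLeast {i | 0 < i ∧ ∃ j, a * i = j * d} (d / Nat.gcd a d) := by
  constructor
  · refine ⟨Nat.div_pos (Nat.gcd_le_right _ hd) (Nat.gcd_pos_of_pos_right _ hd), ?_⟩
    obtain ⟨j, hj⟩ := (dvd_mul_iff_div_gcd_dvd (a := a) hd _).2 dvd_rfl
    exact ⟨j, by rw [hj, mul_comm]⟩
  · rintro i ⟨hi, j, hj⟩
    exact Nat.le_of_dvd hi ((dvd_mul_iff_div_gcd_dvd hd i).1 ⟨j, by rw [hj, mul_comm]⟩)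

theorem pos_of_mk_mem_D {n : ℕ} (hn : 0 < n) {a b c d : ℕ} (h : !![a, b; c, d] ∈ D n) :
    0 < a ∧ 0 < d := by
  simpa using pos_of_mem_D hn h

theorem upper_mem_DB {n : ℕ} (hn : 0 < n) {a b d : ℕ} (h : !![a, b; 0, d] ∈ D n)
    (hb : b < Nat.gcd a d) : !![a, b; 0, d] ∈ DB n := by
  obtain ⟨ha, hd⟩ := pos_of_mk_mem_D hn h
  have h1 := Nat.gcd_le_left d ha
  have h2 := Nat.gcd_le_right a hd
  exact mem_DB_mk.2 ⟨h, ⟨ha, by omega⟩, by omega, hd⟩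

theorem lower_mem_DB {n : ℕ} (hn : 0 < n) {a c d : ℕ} (h : !![a, 0; c, d] ∈ D n)
    (hc : c < Nat.gcd a d) : !![a, 0; c, d] ∈ DB n := by
  obtain ⟨ha, hd⟩ := pos_of_mk_mem_D hn h
  have h1 := Nat.gcd_le_left d ha
  have h2 := Nat.gcd_le_right a hd
  exact mem_DB_mk.2 ⟨h, ⟨by omega, hd⟩, ha, by omega⟩

theorem walk_R_iff {n : ℕ} (hn : 0 < n) {a b d i j : ℕ} (h : !![a, b; 0, d] ∈ DB n) :
    Walk n !![a, b; 0, d] (List.replicate i Letter.R) (List.replicate j Letter.R) !![a, b; 0, d] ↔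
      a * i = j * d := by
  rw [walk_iff hn, mul_replicate_R, replicate_R_mul]
  simp [h]
  omega

theorem walk_L_iff {n : ℕ} (hn : 0 < n) {a c d i j : ℕ} (h : !![a, 0; c, d] ∈ DB n) :
    Walk n !![a, 0; c, d] (List.replicate i Letter.L) (List.replicate j Letter.L) !![a, 0; c, d] ↔
      d * i = j * a := by
  rw [walk_iff hn, mul_replicate_L, replicate_L_mul]
  simp [h]
  omega

theorem nuR_eq {n : ℕ} (hn : 0 < n) {a b d : ℕ} (h : !![a, b; 0, d] ∈ DB n) :
    nuR n !![a, b; 0, d] = d / Nat.gcd a d := by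
  obtain ⟨ha, hd⟩ := pos_of_mk_mem_D hn h.1.1
  simp only [nuR, walk_R_iff hn h]
  exact (isLeast_div_gcd hd).csInf_eq

theorem nuL_eq {n : ℕ} (hn : 0 < n) {a c d : ℕ} (h : !![a, 0; c, d] ∈ DB n) :
    nuL n !![a, 0; c, d] = a / Nat.gcd d a := by
  obtain ⟨ha, hd⟩ := pos_of_mk_mem_D hn h.1.1
  simp only [nuL, walk_L_iff hn h]
  exact (isLeast_div_gcd ha).csInf_eq

theorem mk_mem_RE_iff {n : ℕ} (hn : 0 < n) {a b d : ℕ} :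
    !![a, b; 0, d] ∈ RE n ↔ !![a, b; 0, d] ∈ D n ∧ b < Nat.gcd a d := by
  constructor
  · rintro ⟨⟨h, -⟩, -, h2⟩
    exact ⟨h.1.1, by simpa using h2⟩
  · rintro ⟨h, hb⟩
    have hDB := upper_mem_DB hn h hb
    obtain ⟨ha, hd⟩ := pos_of_mk_mem_D hn h
    refine ⟨⟨hDB, d, a, hd, ha, (walk_R_iff hn hDB).2 rfl⟩, by simp, by simpa using hb⟩

theorem mk_mem_LE_iff {n : ℕ} (hn : 0 < n) {a c d : ℕ} :
    !![a, 0; c, d] ∈ LE n ↔ !![a, 0; c, d] ∈ D n ∧ c < Nat.gcd a d := by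
  constructor
  · rintro ⟨⟨h, -⟩, -, h2⟩
    exact ⟨h.1.1, by simpa using h2⟩
  · rintro ⟨h, hc⟩
    have hDB := lower_mem_DB hn h hc
    obtain ⟨ha, hd⟩ := pos_of_mk_mem_D hn h
    refine ⟨⟨hDB, a, d, ha, hd, (walk_L_iff hn hDB).2 rfl⟩, by simp, by simpa using hc⟩

theorem exists_of_mem_RE {n : ℕ} {M : Mat} (h : M ∈ RE n) : ∃ a b d, M = !![a, b; 0, d] := by
  obtain ⟨a, b, c, d, rfl⟩ := exists_entries M
  have := h.2.1
  simp at this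
  exact ⟨a, b, d, by rw [this]⟩

/-- The Euclidean algorithm, recorded as a word: the first column of a word can be any pair of
coprime numbers `p, q` with `p > 0`, and the second column can be taken to be small. -/
theorem exists_word_of_coprime {p q : ℕ} (hp : 0 < p) (h : Nat.Coprime p q) :
    ∃ (U : Word) (x y : ℕ), mu U = !![p, x; q, y] ∧ p * y = 1 + q * x ∧ x ≤ p ∧
      (0 < q → y ≤ q) := by
  induction hs : p + q using Nat.strong_induction_on generalizing p q with
  | _ s ih =>
  rcases Nat.eq_zero_or_pos q with rfl | hq
  · rw [Nat.coprime_zero_right] at h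
    subst h
    exact ⟨[], 0, 1, by simp [mu_nil, Matrix.one_fin_two], by simp, by simp, by simp⟩
  rcases lt_trichotomy p q with hlt | rfl | hlt
  · obtain ⟨q, rfl⟩ := Nat.exists_eq_add_of_lt hlt
    obtain ⟨U, x, y, h1, h2, h3, h4⟩ := ih (p + (q + 1)) (by omega) hp
      (q := q + 1) (by rw [add_assoc] at h; simpa using h) rfl
    refine ⟨Letter.L :: U, x, x + y, ?_, by nlinarith, h3, fun _ => by have := h4 (by omega); omega⟩
    rw [mu_cons, h1]
    simp [Letter.mat, add_assoc]
  · rw [Nat.coprime_self] at h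
    subst h
    exact ⟨[Letter.L], 0, 1, by simp [mu, Letter.mat], by simp, by simp, by simp⟩
  · obtain ⟨p, rfl⟩ := Nat.exists_eq_add_of_lt hlt
    obtain ⟨U, x, y, h1, h2, h3, h4⟩ := ih (p + 1 + q) (by omega) (p := p + 1) (q := q)
      (by omega) (by rw [add_assoc] at h; simpa using h) rfl
    have := h4 hq
    refine ⟨Letter.R :: U, x + y, y, ?_, by nlinarith, by omega, h4⟩
    rw [mu_cons, h1]
    simp [Letter.mat]
    ring

/-- Among `d / gcd(a, d)` consecutive values of `j`, one makes the residue of `a j + e` modulo `d`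
less than `gcd(a, d)`. -/
theorem exists_mem_window {a d : ℕ} (hd : 0 < d) (e T : ℕ) (hT : d / Nat.gcd a d ≤ T) :
    ∃ j, T < j + d / Nat.gcd a d ∧ j ≤ T ∧ (a * j + e) % d < Nat.gcd a d := by
  obtain ⟨a', d', hc, ha, hd'⟩ := Nat.exists_coprime a d
  have hg : 0 < Nat.gcd a d := Nat.gcd_pos_of_pos_right _ hd
  generalize Nat.gcd a d = g at *
  subst ha hd'
  rw [Nat.mul_div_cancel _ hg] at *
  have hd' : 0 < d' := Nat.pos_of_mul_pos_right hd
  obtain ⟨u, v, huv⟩ : ∃ u v : ℤ, u * a' + v * d' = 1 := by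
    exact Int.isCoprime_iff_gcd_eq_one.2 (by simpa using hc)
  have hz : (0 : ℤ) < d' := by exact_mod_cast hd'
  set f : ℤ := ((e / g : ℕ) : ℤ) with hf
  set s := ((T : ℤ) + u * f) % d' with hs
  have hs0 : 0 ≤ s := Int.emod_nonneg _ hz.ne'
  have hs1 : s < d' := Int.emod_lt_of_pos _ hz
  obtain ⟨j, hj⟩ : ∃ j : ℕ, (j : ℤ) = T - s := ⟨(T - s).toNat, by omega⟩
  refine ⟨j, by omega, by omega, ?_⟩
  have hdvd : d' ∣ a' * j + e / g := by
    zify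
    rw [hj]
    have hT' : (T : ℤ) + u * f = d' * (((T : ℤ) + u * f) / d') + s := by
      rw [hs]; exact (Int.mul_ediv_add_emod _ _).symm
    refine ⟨a' * (((T : ℤ) + u * f) / d') + v * f, ?_⟩
    have : (e : ℤ) / g = f := by simp [hf]
    rw [this]
    linear_combination (a' : ℤ) * hT' - f * huv
  obtain ⟨k, hk⟩ := hdvd
  have he := Nat.div_add_mod e g
  have : a' * g * j + e = d' * g * k + e % g := by
    conv_lhs => rw [← he]
    linear_combination g * hk
  rw [this, Nat.mul_add_mod]
  exact (Nat.mod_le _ _).trans_lt (Nat.mod_lt _ hg)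

/-- From any matrix of `D n`, reading `R`s leads to a state of `RE n` at some moment of the
window `(3 n - ν_R(N), 3 n]`; by then the output ends with `R`. -/
theorem exists_mem_RE {n : ℕ} (hn : 0 < n) {P : Mat} (hP : P ∈ D n) :
    ∃ (N : Mat) (j : ℕ) (W : Word), N ∈ RE n ∧ 3 * n < j + nuR n N ∧ j ≤ 3 * n ∧
      P * mu (List.replicate j Letter.R) = mu (W ++ [Letter.R]) * N := by
  obtain ⟨α, β, γ, δ, rfl⟩ := exists_entries P
  have hα := (pos_of_mk_mem_D hn hP).1
  have hdet := (mem_D_mk.1 hP).1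
  obtain ⟨p, q, hc, hpa, hqa⟩ := Nat.exists_coprime α γ
  have ha : 0 < Nat.gcd α γ := Nat.gcd_pos_of_pos_left _ hα
  generalize Nat.gcd α γ = a at *
  have hp : 0 < p := Nat.pos_of_ne_zero (by rintro rfl; omega)
  obtain ⟨U, x, y, hU, hxy, hx, -⟩ := exists_word_of_coprime hp hc
  subst hpa hqa
  -- `d` is the lower right entry of `U⁻¹ P`, and `e - d` its upper right one
  obtain ⟨d, hd⟩ : ∃ d, p * δ = d + q * β := by
    have : q * β ≤ p * δ := by
      by_contra! h
      nlinarith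
    exact ⟨p * δ - q * β, by omega⟩
  have hn' : n = a * d := by nlinarith
  have hdpos : 0 < d := Nat.pos_of_ne_zero (by rintro rfl; omega)
  obtain ⟨e, he⟩ : ∃ e, d + y * β = x * δ + e := by
    -- this is where the second column of `U` has to be small: `x ≤ p`
    have : x * δ ≤ d + y * β := by
      have h1 : p * (x * δ) + β = x * d + p * (y * β) := by
        linear_combination x * hd - β * hxy
      have h2 : x * d ≤ p * d := Nat.mul_le_mul_right _ hx
      by_contra! h
      have := Nat.mul_lt_mul_of_pos_left h hp
      nlinarith
    exact ⟨d + y * β - x * δ, by omega⟩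
  have hdn : d ≤ n := hn' ▸ Nat.le_mul_of_pos_left d ha
  have hdg : d / Nat.gcd a d ≤ d := Nat.div_le_self _ _
  obtain ⟨j, hj1, hj2, hj3⟩ := exists_mem_window (a := a) hdpos e (3 * n) (by omega)
  have hdiv := Nat.div_add_mod (a * j + e) d
  -- the quotient is the number of trailing `R`s plus one, so the output ends with `R`
  have hbig : 2 ≤ (a * j + e) / d := by
    rw [Nat.le_div_iff_mul_le hdpos]
    nlinarith
  obtain ⟨t, ht⟩ := Nat.exists_eq_add_of_le hbig
  generalize (a * j + e) % d = b at *
  rw [ht] at hdiv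
  have hmul : !![p * a, β; q * a, δ] * mu (List.replicate j Letter.R) =
      mu ((U ++ List.replicate t Letter.R) ++ [Letter.R]) * !![a, b; 0, d] := by
    have : [Letter.R] = List.replicate 1 Letter.R := rfl
    rw [this, List.append_assoc, ← List.replicate_add, mul_replicate_R, mu_append,
      mul_assoc (mu U), replicate_R_mul, hU, Matrix.mul_fin_two]
    have h1 : p * a * j + β = p * (b + (t + 1) * d) + x * d := by
      zify at *
      linear_combination (-p : ℤ) * hdiv + p * he + x * hd - β * hxy
    have h2 : q * a * j + δ = q * (b + (t + 1) * d) + y * d := by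
      zify at *
      linear_combination (-q : ℤ) * hdiv + q * he + y * hd - δ * hxy
    rw [h1, h2]
    simp
  have hD : !![a, b; 0, d] ∈ D n := by
    rw [← mu_mul_mem_D n _ _, ← hmul, mul_mu_mem_D]
    exact hP
  refine ⟨_, j, _, (mk_mem_RE_iff hn).2 ⟨hD, hj3⟩, ?_, hj2, hmul⟩
  rwa [nuR_eq hn (upper_mem_DB hn hD hj3)]

/-- If `N` and `N'` occur at the times `j ≤ j'`, they lie on the same cycle of reading `R`s; their
upper right entries are congruent modulo the gcd and less than it, so `N' = N`, and `j' - j` is a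
multiple of the period `ν_R(N)`, larger than the window allows unless it is `0`. -/
theorem mem_RE_window_unique_of_le {n : ℕ} (hn : 0 < n) {P N N' : Mat} {j j' : ℕ} {W W' : Word}
    (hN : N ∈ RE n) (hj : 3 * n < j + nuR n N)
    (h : P * mu (List.replicate j Letter.R) = mu W * N)
    (hN' : N' ∈ RE n) (hj' : j' ≤ 3 * n)
    (h' : P * mu (List.replicate j' Letter.R) = mu W' * N') (hle : j ≤ j') :
    N = N' ∧ j = j' ∧ W = W' := by
  obtain ⟨a, b, d, rfl⟩ := exists_of_mem_RE hN
  obtain ⟨a', b', d', rfl⟩ := exists_of_mem_RE hN'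
  obtain ⟨hD, hb⟩ := (mk_mem_RE_iff hn).1 hN
  obtain ⟨hD', hb'⟩ := (mk_mem_RE_iff hn).1 hN'
  obtain ⟨ha, hd⟩ := pos_of_mk_mem_D hn hD
  obtain ⟨s, rfl⟩ := Nat.exists_eq_add_of_le hle
  rw [nuR_eq hn (upper_mem_DB hn hD hb)] at hj
  have hdiv := Nat.div_add_mod (a * s + b) d
  have hRB : !![a, (a * s + b) % d; 0, d] ∈ RB n := by
    have hdet := (mem_D_mk.1 hD).1
    have : !![a, (a * s + b) % d; 0, d] ∈ D n := by
      rw [← mu_mul_mem_D n (List.replicate ((a * s + b) / d) Letter.R), replicate_R_mul,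
        add_comm _ (_ * d), mul_comm _ d, hdiv, mul_zero, add_zero]
      have := (mul_mu_mem_D n (List.replicate s Letter.R) _).2 hD
      rwa [mul_replicate_R, zero_mul, zero_add] at this
    exact mem_RB_mk.2 ⟨this, ha, Nat.mod_lt _ hd⟩
  have key : mu (W ++ List.replicate ((a * s + b) / d) Letter.R) *
      !![a, (a * s + b) % d; 0, d] = mu W' * !![a', b'; 0, d'] := by
    rw [← h', List.replicate_add, mu_append, mu_append, ← mul_assoc, h, mul_assoc, mul_assoc,
      mul_replicate_R, replicate_R_mul, add_comm _ (_ * d), mul_comm _ d, hdiv]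
    simp
  obtain ⟨-, h2⟩ := reduction_unique hn hRB (upper_mem_DB hn hD' hb').1 key
  simp at h2
  obtain ⟨⟨rfl, rfl⟩, rfl⟩ := h2
  have hbb : (a * s + b) % d = b := by
    have h3 : (a * s + b) % d ≡ b [MOD Nat.gcd a d] := by
      have h4 : (a * s + b) % d ≡ a * s + b [MOD Nat.gcd a d] :=
        (Nat.mod_modEq _ d).of_dvd (Nat.gcd_dvd_right a d)
      refine h4.trans ?_
      have h5 : a * s ≡ 0 [MOD Nat.gcd a d] :=
        (Nat.modEq_zero_iff_dvd).2 ((Nat.gcd_dvd_left a d).mul_right s)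
      simpa using h5.add_right b
    exact Nat.ModEq.eq_of_lt_of_lt h3 hb' hb
  have hs : d ∣ a * s := by
    refine ⟨(a * s + b) / d, ?_⟩
    omega
  rw [dvd_mul_iff_div_gcd_dvd hd] at hs
  have hs0 : s = 0 := Nat.eq_zero_of_dvd_of_lt hs (by omega)
  subst hs0
  have hb2 : b % d = b := by simpa using hbb
  rw [add_zero] at h'
  have := reduction_unique hn (upper_mem_DB hn hD hb).1 (upper_mem_DB hn hD' hb').1
    (h.symm.trans h')
  exact ⟨this.2, rfl, this.1⟩

theorem mem_RE_window_unique {n : ℕ} (hn : 0 < n) {P N N' : Mat} {j j' : ℕ} {W W' : Word}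
    (hN : N ∈ RE n) (hj1 : 3 * n < j + nuR n N) (hj2 : j ≤ 3 * n)
    (h : P * mu (List.replicate j Letter.R) = mu W * N)
    (hN' : N' ∈ RE n) (hj1' : 3 * n < j' + nuR n N') (hj2' : j' ≤ 3 * n)
    (h' : P * mu (List.replicate j' Letter.R) = mu W' * N') :
    N = N' ∧ j = j' ∧ W = W' := by
  rcases le_total j j' with hle | hle
  · exact mem_RE_window_unique_of_le hn hN hj1 h hN' hj2' h' hle
  · obtain ⟨h1, h2, h3⟩ := mem_RE_window_unique_of_le hn hN' hj1' h' hN hj2 h hle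
    exact ⟨h1.symm, h2.symm, h3.symm⟩

theorem isLRData_iff {n : ℕ} (hn : 0 < n) {M N : Mat} {i j : ℕ} {W : Word} (hM : M ∈ LE n) :
    IsLRData n M i N j W ↔ N ∈ RE n ∧ 3 * n < j + nuR n N ∧ j ≤ 3 * n ∧
      M * mu (List.replicate i Letter.L) * mu (List.replicate j Letter.R) = mu W * N := by
  simp only [IsLRData, walk_iff hn, mu_append, mul_assoc]
  constructor
  · rintro ⟨h1, h2, h3, -, -, h4⟩
    exact ⟨h1, h2, h3, h4⟩
  · rintro ⟨h1, h2, h3, h4⟩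
    exact ⟨h1, h2, h3, hM.1.1, h1.1.1, h4⟩

theorem existsUnique_isLRData {n : ℕ} (hn : 0 < n) {M : Mat} (hM : M ∈ LE n) (i : ℕ) :
    ∃! t : Mat × ℕ × Word, IsLRData n M i t.1 t.2.1 t.2.2 := by
  have hD : M * mu (List.replicate i Letter.L) ∈ D n := (mul_mu_mem_D n _ _).2 hM.1.1.1.1
  obtain ⟨N, j, W, h1, h2, h3, h4⟩ := exists_mem_RE hn hD
  refine ⟨(N, j, W ++ [Letter.R]), (isLRData_iff hn hM).2 ⟨h1, h2, h3, h4⟩, ?_⟩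
  rintro ⟨N', j', W'⟩ h'
  obtain ⟨h1', h2', h3', h4'⟩ := (isLRData_iff hn hM).1 h'
  obtain ⟨rfl, rfl, rfl⟩ := mem_RE_window_unique hn h1' h2' h3' h4' h1 h2 h3 h4
  rfl

theorem wordL_eq {n : ℕ} (hn : 0 < n) {M N : Mat} (hM : M ∈ LE n) {i j : ℕ} {W : Word}
    (h : IsLRData n M i N j W) : wordL n M i = W := by
  have hex : ∃ W : Word, ∃ (N : Mat) (j : ℕ), IsLRData n M i N j W := ⟨W, N, j, h⟩
  rw [wordL, dif_pos hex]
  obtain ⟨N', j', h'⟩ := hex.choose_spec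
  have := (existsUnique_isLRData hn hM i).unique (y₁ := (N', j', hex.choose)) (y₂ := (N, j, W)) h' h
  simp only [Prod.mk.injEq] at this
  exact this.2.2

/-! ### Changes of letters in a word -/

/-- The number of positions at which two consecutive letters differ. -/
def switches : Word → ℕ
  | [] => 0
  | [_] => 0
  | x :: y :: t => (if x = y then 0 else 1) + switches (y :: t)

theorem switches_cons_cons (x y : Letter) (t : Word) :
    switches (x :: y :: t) = (if x = y then 0 else 1) + switches (y :: t) := rfl

/-- The invariant of the loop that computes the runs: each change of letters closes a run. -/
theorem length_splitBy_loop (l : Word) (a : Letter) (g : Word) (gs : List Word) :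
    (List.splitBy.loop (fun x y : Letter => decide (x = y)) l a g gs).length =
      gs.length + 1 + switches (a :: l) := by
  induction l generalizing a g gs with
  | nil => simp [List.splitBy.loop, switches]
  | cons b l ih =>
    by_cases h : a = b
    · simp [List.splitBy.loop, switches, ih, h]
    · simp [List.splitBy.loop, switches, ih, h]
      omega

theorem sigma_cons (x : Letter) (t : Word) : sigma (x :: t) = switches (x :: t) + 1 := by
  rw [sigma, runs, List.splitBy, length_splitBy_loop, List.length_nil]
  omega

theorem sigma_of_ne_nil {V : Word} (h : V ≠ []) : sigma V = switches V + 1 := by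
  obtain ⟨x, t, rfl⟩ := List.exists_cons_of_ne_nil h
  exact sigma_cons x t

theorem switches_append_cons (A : Word) (x : Letter) (B : Word) :
    switches (A ++ x :: B) = switches (A ++ [x]) + switches (x :: B) := by
  induction A with
  | nil => simp [switches]
  | cons a A ih =>
    cases A with
    | nil => simp [switches]
    | cons b A =>
      simp only [List.cons_append, switches_cons_cons] at ih ⊢
      omega

theorem switches_replicate_append (s : ℕ) (x : Letter) (T : Word) :
    switches (List.replicate (s + 1) x ++ T) = switches (x :: T) := by
  induction s with
  | zero => rfl
  | succ s ih =>
    rw [← ih, List.replicate_succ, List.replicate_succ, List.cons_append, List.cons_append,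
      switches_cons_cons]
    simp

theorem switches_append_replicate (A : Word) (x : Letter) (s : ℕ) :
    switches (A ++ [x] ++ List.replicate s x) = switches (A ++ [x]) := by
  rw [List.append_assoc, List.singleton_append, switches_append_cons]
  have := switches_replicate_append s x []
  rw [List.append_nil, List.replicate_succ] at this
  rw [this]
  rfl

/-! ### The symmetry between `L` and `R` -/

/-- The other letter. -/
def Letter.swap : Letter → Letter
  | Letter.L => Letter.R
  | Letter.R => Letter.L

theorem Letter.swap_swap (Z : Letter) : Z.swap.swap = Z := by cases Z <;> rfl

theorem Letter.swap_injective : Function.Injective Letter.swap := by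
  intro x y
  cases x <;> cases y <;> simp [Letter.swap]

theorem Letter.eq_swap_of_ne {x y : Letter} (h : x ≠ y) : y = x.swap := by
  cases x <;> cases y <;> simp_all [Letter.swap]

theorem switches_map_swap (V : Word) : switches (V.map Letter.swap) = switches V := by
  induction V with
  | nil => rfl
  | cons x V ih =>
    cases V with
    | nil => rfl
    | cons y V =>
      simp only [List.map_cons, switches_cons_cons, Letter.swap_injective.eq_iff] at ih ⊢
      rw [ih]

/-- The conjugate of a matrix by the permutation matrix that exchanges the letters `L` and `R`. -/
def swapMat (M : Mat) : Mat := !![M 1 1, M 1 0; M 0 1, M 0 0]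

theorem swapMat_mk (a b c d : ℕ) : swapMat !![a, b; c, d] = !![d, c; b, a] := by simp [swapMat]

theorem swapMat_swapMat (M : Mat) : swapMat (swapMat M) = M := by
  obtain ⟨a, b, c, d, rfl⟩ := exists_entries M
  simp [swapMat_mk]

theorem swapMat_mul (M N : Mat) : swapMat (M * N) = swapMat M * swapMat N := by
  obtain ⟨a, b, c, d, rfl⟩ := exists_entries M
  obtain ⟨a', b', c', d', rfl⟩ := exists_entries N
  simp [swapMat_mk, add_comm]

theorem swapMat_mu (V : Word) : swapMat (mu V) = mu (V.map Letter.swap) := by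
  induction V with
  | nil => simp [mu_nil, Matrix.one_fin_two, swapMat_mk]
  | cons Z V ih =>
    rw [mu_cons, swapMat_mul, ih, List.map_cons, mu_cons]
    cases Z <;> simp [Letter.mat, Letter.swap, swapMat_mk]

theorem swapMat_mem_D {n : ℕ} {M : Mat} (h : M ∈ D n) : swapMat M ∈ D n := by
  obtain ⟨a, b, c, d, rfl⟩ := exists_entries M
  rw [swapMat_mk]
  rw [mem_D_mk] at h ⊢
  refine ⟨by linarith [h.1, mul_comm a d, mul_comm b c], fun k h1 h2 h3 h4 => h.2 k h4 h3 h2 h1⟩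

theorem swapMat_mem_RB {n : ℕ} {M : Mat} (h : M ∈ RB n) : swapMat M ∈ RB n := by
  refine ⟨swapMat_mem_D h.1, ?_, ?_⟩
  · simpa [swapMat] using h.2.2
  · simpa [swapMat] using h.2.1

/-! ### Row-balanced part and output of a matrix -/

open Classical in
/-- The row-balanced factor `N` of a matrix `P = μ(W) N`; the value is `P` if there is none. -/
noncomputable def nf (n : ℕ) (P : Mat) : Mat :=
  if h : ∃ (N : Mat) (W : Word), N ∈ RB n ∧ P = mu W * N then h.choose else P

open Classical in
/-- The word `W` in the factorization `P = μ(W) N` with `N` row-balanced, that is, the letters that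
can be written when `P` has been reached; the value is `[]` if there is no such factorization. -/
noncomputable def out (n : ℕ) (P : Mat) : Word :=
  if h : ∃ (W : Word) (N : Mat), N ∈ RB n ∧ P = mu W * N then h.choose else []

theorem nf_out_eq {n : ℕ} (hn : 0 < n) {P N : Mat} {W : Word} (hN : N ∈ RB n) (h : P = mu W * N) :
    nf n P = N ∧ out n P = W := by
  have h1 : ∃ (N : Mat) (W : Word), N ∈ RB n ∧ P = mu W * N := ⟨N, W, hN, h⟩
  have h2 : ∃ (W : Word) (N : Mat), N ∈ RB n ∧ P = mu W * N := ⟨W, N, hN, h⟩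
  rw [nf, out, dif_pos h1, dif_pos h2]
  obtain ⟨W', h3, h4⟩ := h1.choose_spec
  obtain ⟨N', h5, h6⟩ := h2.choose_spec
  exact ⟨(reduction_unique hn h3 hN (h4.symm.trans h)).2,
    (reduction_unique hn h5 hN (h6.symm.trans h)).1⟩

theorem nf_out_spec {n : ℕ} (hn : 0 < n) {P : Mat} (hP : P ∈ D n) :
    nf n P ∈ RB n ∧ P = mu (out n P) * nf n P := by
  obtain ⟨W, N, hN, h⟩ := exists_reduction hn P hP
  obtain ⟨h1, h2⟩ := nf_out_eq hn hN h
  rw [h1, h2]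
  exact ⟨hN, h⟩

theorem nf_mem {n : ℕ} (hn : 0 < n) {P : Mat} (hP : P ∈ D n) : nf n P ∈ RB n :=
  (nf_out_spec hn hP).1

theorem nf_of_mem_RB {n : ℕ} (hn : 0 < n) {P : Mat} (hP : P ∈ RB n) : nf n P = P :=
  (nf_out_eq hn (W := []) hP (by rw [mu_nil, one_mul])).1

theorem nf_mu_mul {n : ℕ} (hn : 0 < n) {P : Mat} (hP : P ∈ D n) (W : Word) :
    nf n (mu W * P) = nf n P ∧ out n (mu W * P) = W ++ out n P := by
  obtain ⟨h1, h2⟩ := nf_out_spec hn hP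
  exact nf_out_eq hn h1 (by rw [mu_append, mul_assoc, ← h2])

theorem nf_mul_mu {n : ℕ} (hn : 0 < n) {P : Mat} (hP : P ∈ D n) (V : Word) :
    nf n (P * mu V) = nf n (nf n P * mu V) ∧
      out n (P * mu V) = out n P ++ out n (nf n P * mu V) := by
  obtain ⟨h1, h2⟩ := nf_out_spec hn hP
  have := nf_mu_mul hn ((mul_mu_mem_D n V _).2 h1.1) (out n P)
  rwa [← mul_assoc, ← h2] at this

theorem nf_swapMat {n : ℕ} (hn : 0 < n) {P : Mat} (hP : P ∈ D n) :
    nf n (swapMat P) = swapMat (nf n P) ∧ out n (swapMat P) = (out n P).map Letter.swap := by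
  obtain ⟨h1, h2⟩ := nf_out_spec hn hP
  exact nf_out_eq hn (swapMat_mem_RB h1) (by rw [← swapMat_mu, ← swapMat_mul, ← h2])

/-! ### Reading one run -/

/-- Reading `R`s from `P` long enough, the transducer ends in an upper triangular matrix and its
output is a fixed word that ends with `R`, followed by more `R`s. -/
theorem nf_mul_replicate_R {n : ℕ} (hn : 0 < n) {P : Mat} (hP : P ∈ D n) {b : ℕ}
    (hb : 3 * n ≤ b) {N : Mat} {j : ℕ} {W : Word} (hN : N ∈ RE n) (hj : j ≤ 3 * n)
    (h : P * mu (List.replicate j Letter.R) = mu (W ++ [Letter.R]) * N) :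
    nf n (P * mu (List.replicate b Letter.R)) 1 0 = 0 ∧
      ∃ t, out n (P * mu (List.replicate b Letter.R)) =
        W ++ [Letter.R] ++ List.replicate t Letter.R := by
  obtain ⟨s, rfl⟩ := Nat.exists_eq_add_of_le (hj.trans hb)
  obtain ⟨a, b, d, rfl⟩ := exists_of_mem_RE hN
  have hD := ((mk_mem_RE_iff hn).1 hN).1
  obtain ⟨ha, hd⟩ := pos_of_mk_mem_D hn hD
  have hdiv := Nat.div_add_mod (a * s + b) d
  have heq : P * mu (List.replicate (j + s) Letter.R) =
      mu (W ++ [Letter.R] ++ List.replicate ((a * s + b) / d) Letter.R) *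
        !![a, (a * s + b) % d; 0, d] := by
    rw [List.replicate_add, mu_append, ← mul_assoc, h, mul_assoc, mul_replicate_R,
      mu_append (W ++ [Letter.R]), mul_assoc (mu (W ++ [Letter.R])), replicate_R_mul,
      add_comm _ (_ * d), mul_comm _ d, hdiv]
    simp
  have hRB : !![a, (a * s + b) % d; 0, d] ∈ RB n := by
    refine mem_RB_mk.2 ⟨?_, ha, Nat.mod_lt _ hd⟩
    rw [← mu_mul_mem_D n _ _, ← heq, mul_mu_mem_D]
    exact hP
  obtain ⟨h1, h2⟩ := nf_out_eq hn hRB heq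
  exact ⟨by rw [h1]; simp, _, h2⟩

/-- The number of changes of letters in the output when the transducer, having just written the
letter `Z`, reads a long run of the other letter from `Q`. -/
noncomputable def weight (n : ℕ) (Z : Letter) (Q : Mat) : ℕ :=
  switches (Z :: out n (Q * mu (List.replicate (3 * n) Z.swap)))

theorem read_run_R {n : ℕ} (hn : 0 < n) {Q : Mat} (hQ : Q ∈ D n) {b : ℕ} (hb : 3 * n ≤ b) :
    nf n (Q * mu (List.replicate b Letter.R)) 1 0 = 0 ∧
      (∃ U, out n (Q * mu (List.replicate b Letter.R)) = U ++ [Letter.R]) ∧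
      switches (Letter.L :: out n (Q * mu (List.replicate b Letter.R))) = weight n Letter.L Q := by
  obtain ⟨N, j, W, h1, -, h3, h4⟩ := exists_mem_RE hn hQ
  obtain ⟨h5, t, h6⟩ := nf_mul_replicate_R hn hQ hb h1 h3 h4
  obtain ⟨-, t', h7⟩ := nf_mul_replicate_R hn hQ le_rfl h1 h3 h4
  refine ⟨h5, ⟨W ++ List.replicate t Letter.R, ?_⟩, ?_⟩
  · rw [h6, List.append_assoc, List.append_assoc, List.singleton_append, ← List.replicate_succ,
      List.replicate_succ']
  · rw [weight, Letter.swap, h6, h7]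
    simp only [← List.cons_append, switches_append_replicate]

theorem weight_swapMat {n : ℕ} (hn : 0 < n) {Q : Mat} (hQ : Q ∈ D n) (Z : Letter) :
    weight n Z (swapMat Q) = weight n Z.swap Q := by
  rw [weight, weight, ← switches_map_swap, List.map_cons,
    ← (nf_swapMat hn ((mul_mu_mem_D n _ _).2 (swapMat_mem_D hQ))).2, swapMat_mul, swapMat_swapMat,
    swapMat_mu, List.map_replicate]

theorem read_run_L {n : ℕ} (hn : 0 < n) {Q : Mat} (hQ : Q ∈ D n) {a : ℕ} (ha : 3 * n ≤ a) :
    nf n (Q * mu (List.replicate a Letter.L)) 0 1 = 0 ∧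
      (∃ U, out n (Q * mu (List.replicate a Letter.L)) = U ++ [Letter.L]) ∧
      switches (Letter.R :: out n (Q * mu (List.replicate a Letter.L))) = weight n Letter.R Q := by
  obtain ⟨h1, ⟨U, h2⟩, h3⟩ := read_run_R hn (swapMat_mem_D hQ) ha
  have hD : Q * mu (List.replicate a Letter.L) ∈ D n := (mul_mu_mem_D n _ _).2 hQ
  have heq : swapMat Q * mu (List.replicate a Letter.R) =
      swapMat (Q * mu (List.replicate a Letter.L)) := by
    rw [swapMat_mul, swapMat_mu, List.map_replicate]; rfl
  obtain ⟨h4, h5⟩ := nf_swapMat hn hD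
  rw [heq, h4] at h1
  rw [heq, h5] at h2 h3
  refine ⟨by simpa [swapMat] using h1, ⟨U.map Letter.swap, ?_⟩, ?_⟩
  · have := congrArg (List.map Letter.swap) h2
    rw [List.map_append, List.map_map, show Letter.swap ∘ Letter.swap = id from
      funext Letter.swap_swap, List.map_id] at this
    exact this
  · rw [weight_swapMat hn hQ] at h3
    rw [← switches_map_swap]
    exact h3

/-- Every lower triangular row-balanced matrix `Q` is reached from some state `M` of `LE n` by
reading `i` letters `L` with `ν_L(M) ≤ i < 2 ν_L(M)`, and at least one `L` is written on the way. -/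
theorem exists_cut {n : ℕ} (hn : 0 < n) {Q : Mat} (hQ : Q ∈ RB n) (h0 : Q 0 1 = 0) :
    ∃ M ∈ LE n, ∃ i ∈ Finset.Ico (nuL n M) (2 * nuL n M), ∃ s,
      M * mu (List.replicate i Letter.L) = mu (List.replicate (s + 1) Letter.L) * Q := by
  obtain ⟨a, b, c, d, rfl⟩ := exists_entries Q
  obtain rfl : b = 0 := by simpa using h0
  obtain ⟨hD, hca, -⟩ := mem_RB_mk.1 hQ
  obtain ⟨ha, hd⟩ := pos_of_mk_mem_D hn hD
  have hg : 0 < Nat.gcd d a := Nat.gcd_pos_of_pos_left _ hd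
  have hc := Nat.div_add_mod c (Nat.gcd d a)
  obtain ⟨hdet, hprim⟩ := mem_D_mk.1 hD
  have hD' : !![a, 0; c % Nat.gcd d a, d] ∈ D n := by
    refine mem_D_mk.2 ⟨by simpa using hdet, fun k h1 h2 h3 h4 => hprim k h1 h2 ?_ h4⟩
    rw [← hc]
    exact dvd_add ((Nat.dvd_gcd h4 h1).mul_right _) h3
  have hlt : c % Nat.gcd d a < Nat.gcd a d := by
    rw [Nat.gcd_comm a d]; exact Nat.mod_lt _ hg
  have hnu := nuL_eq hn (lower_mem_DB hn hD' hlt)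
  have hnupos : 0 < a / Nat.gcd d a := Nat.div_pos (Nat.gcd_le_right _ ha) hg
  -- the number `e` is congruent to `-(c - c % gcd)` modulo `a`
  obtain ⟨e, he⟩ : ∃ e, a * c = Nat.gcd d a * (c / Nat.gcd d a) + e := by
    have : c ≤ a * c := Nat.le_mul_of_pos_left c ha
    exact ⟨a * c - Nat.gcd d a * (c / Nat.gcd d a), by omega⟩
  obtain ⟨i, hi1, hi2, hi3⟩ := exists_mem_window (a := d) ha e (2 * (a / Nat.gcd d a) - 1)
    (by omega)
  have hdvd : Nat.gcd d a ∣ (d * i + e) % a := by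
    rw [Nat.dvd_mod_iff (Nat.gcd_dvd_right d a)]
    refine dvd_add ((Nat.gcd_dvd_left d a).mul_right i) ?_
    rw [← Nat.dvd_add_right (Dvd.intro (c / Nat.gcd d a) rfl), ← he]
    exact (Nat.gcd_dvd_right d a).mul_right c
  -- the residue is a multiple of the gcd and less than the gcd
  have hmod := Nat.eq_zero_of_dvd_of_lt hdvd hi3
  obtain ⟨k, hk⟩ := Nat.dvd_of_mod_eq_zero hmod
  have hai : a ≤ d * i := by
    obtain ⟨d', hd'⟩ := Nat.gcd_dvd_left d a
    have hd'0 : 0 < d' := Nat.pos_of_ne_zero (by rintro rfl; omega)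
    calc a = Nat.gcd d a * (a / Nat.gcd d a) := (Nat.mul_div_cancel' (Nat.gcd_dvd_right d a)).symm
      _ ≤ d * i := Nat.mul_le_mul (Nat.gcd_le_left _ hd) (by omega)
  have hlt' : a * c < a * k := by omega
  obtain ⟨s, rfl⟩ := Nat.exists_eq_add_of_lt (Nat.lt_of_mul_lt_mul_left hlt')
  refine ⟨_, (mk_mem_LE_iff hn).2 ⟨hD', hlt⟩, i, ?_, s, ?_⟩
  · rw [hnu, Finset.mem_Ico]; omega
  · rw [mul_replicate_L, replicate_L_mul]
    have : c % Nat.gcd d a + d * i = (s + 1) * a + c := by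
      have : a * (c + s + 1) = a * c + (s + 1) * a := by ring
      omega
    simp [this]

theorem weight_eq_of_cut {n : ℕ} (hn : 0 < n) {M Q : Mat} (hM : M ∈ LE n) (hQ : Q ∈ D n)
    {i s : ℕ}
    (h : M * mu (List.replicate i Letter.L) = mu (List.replicate (s + 1) Letter.L) * Q) :
    weight n Letter.L Q = sigma (wordL n M i) - 1 := by
  obtain ⟨N, j, W, h1, h2, h3, h4⟩ := exists_mem_RE hn hQ
  obtain ⟨-, t, h5⟩ := nf_mul_replicate_R hn hQ le_rfl h1 h3 h4
  have hdata : IsLRData n M i N j (List.replicate (s + 1) Letter.L ++ (W ++ [Letter.R])) := by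
    refine (isLRData_iff hn hM).2 ⟨h1, h2, h3, ?_⟩
    rw [h, mul_assoc, h4, mu_append (List.replicate _ _), mul_assoc]
  rw [wordL_eq hn hM hdata, sigma_of_ne_nil (by simp), switches_replicate_append, weight,
    Letter.swap, h5, ← List.cons_append, ← List.cons_append, switches_append_replicate,
    Nat.add_sub_cancel]

/-- The sum of `σ(W_{L,M,i}) - 1` over all `M ∈ LE n` and `ν_L(M) ≤ i < 2 ν_L(M)`. -/
noncomputable def totalWeight (n : ℕ) : ℕ :=
  ∑ N ∈ (LE_finite n).toFinset, ∑ i ∈ Finset.Ico (nuL n N) (2 * nuL n N),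
    (sigma (wordL n N i) - 1)

/-- A row-balanced lower triangular matrix is determined by its cut, so the weights of different
such matrices are different terms of the sum. -/
theorem sum_weight_L_le {n : ℕ} (hn : 0 < n) (T : Finset Mat)
    (hT : ∀ Q ∈ T, Q ∈ RB n ∧ Q 0 1 = 0) : ∑ Q ∈ T, weight n Letter.L Q ≤ totalWeight n := by
  have hex : ∀ Q ∈ T, ∃ p : (_ : Mat) × ℕ,
      (p.1 ∈ LE n ∧ p.2 ∈ Finset.Ico (nuL n p.1) (2 * nuL n p.1)) ∧
      ∃ s, p.1 * mu (List.replicate p.2 Letter.L) = mu (List.replicate (s + 1) Letter.L) * Q := by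
    intro Q hQ
    obtain ⟨M, hM, i, hi, s, hs⟩ := exists_cut hn (hT Q hQ).1 (hT Q hQ).2
    exact ⟨⟨M, i⟩, ⟨hM, hi⟩, s, hs⟩
  choose! g hg1 hg2 using hex
  rw [totalWeight, Finset.sum_sigma']
  have hinj : Set.InjOn g T := by
    intro Q hQ Q' hQ' he
    obtain ⟨s, hs⟩ := hg2 Q hQ
    obtain ⟨s', hs'⟩ := hg2 Q' hQ'
    rw [he, hs'] at hs
    exact ((reduction_unique hn (hT Q' hQ').1 (hT Q hQ).1 hs).2).symm
  classical
  calc ∑ Q ∈ T, weight n Letter.L Q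
      = ∑ Q ∈ T, (sigma (wordL n (g Q).1 (g Q).2) - 1) := by
        refine Finset.sum_congr rfl fun Q hQ => ?_
        obtain ⟨s, hs⟩ := hg2 Q hQ
        exact weight_eq_of_cut hn (hg1 Q hQ).1 (hT Q hQ).1.1 hs
    _ = ∑ p ∈ T.image g, (sigma (wordL n p.1 p.2) - 1) := (Finset.sum_image
        (f := fun p : (_ : Mat) × ℕ => sigma (wordL n p.1 p.2) - 1) hinj).symm
    _ ≤ _ := by
        refine Finset.sum_le_sum_of_subset fun p hp => ?_
        obtain ⟨Q, hQ, rfl⟩ := Finset.mem_image.1 hp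
        simpa using hg1 Q hQ

theorem sum_weight_R_le {n : ℕ} (hn : 0 < n) (T : Finset Mat)
    (hT : ∀ Q ∈ T, Q ∈ RB n ∧ Q 1 0 = 0) : ∑ Q ∈ T, weight n Letter.R Q ≤ totalWeight n := by
  classical
  have hinj : Function.Injective swapMat := fun M N h => by
    rw [← swapMat_swapMat M, h, swapMat_swapMat]
  refine le_trans (le_of_eq ?_) (sum_weight_L_le hn (T.image swapMat) ?_)
  · rw [Finset.sum_image hinj.injOn]
    exact Finset.sum_congr rfl fun Q hQ => (weight_swapMat hn (hT Q hQ).1.1 Letter.L).symm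
  · intro Q hQ
    obtain ⟨Q, hQ', rfl⟩ := Finset.mem_image.1 hQ
    exact ⟨swapMat_mem_RB (hT Q hQ').1, by simpa [swapMat] using (hT Q hQ').2⟩

theorem sigma_wordL_pos {n : ℕ} (hn : 0 < n) {M : Mat} (hM : M ∈ LE n) (i : ℕ) :
    0 < sigma (wordL n M i) := by
  have hD : M * mu (List.replicate i Letter.L) ∈ D n := (mul_mu_mem_D n _ _).2 hM.1.1.1.1
  obtain ⟨N, j, W, h1, h2, h3, h4⟩ := exists_mem_RE hn hD
  rw [wordL_eq hn hM ((isLRData_iff hn hM).2 ⟨h1, h2, h3, h4⟩), sigma_of_ne_nil (by simp)]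
  omega

theorem totalWeight_cast {n : ℕ} (hn : 0 < n) :
    (totalWeight n : ℤ) = ∑ N ∈ (LE_finite n).toFinset,
      ∑ i ∈ Finset.Ico (nuL n N) (2 * nuL n N), ((sigma (wordL n N i) : ℤ) - 1) := by
  rw [totalWeight, Nat.cast_sum]
  refine Finset.sum_congr rfl fun N hN => ?_
  rw [Nat.cast_sum]
  refine Finset.sum_congr rfl fun i _ => ?_
  have := sigma_wordL_pos hn ((LE_finite n).mem_toFinset.1 hN) i
  omega

/-! ### Reading an alternating sequence of long runs -/

/-- Changes of letters add up over a concatenation when every piece is counted with the last letter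
of the preceding one. -/
theorem switches_glue {x y : Letter} {A : Word} (B : Word) (h : ∃ U, x :: A = U ++ [y]) :
    switches (x :: (A ++ B)) = switches (x :: A) + switches (y :: B) := by
  obtain ⟨U, hU⟩ := h
  rw [← List.cons_append, hU, List.append_assoc, List.singleton_append, switches_append_cons]

/-- The word `L ^ a₁ R ^ b₁ L ^ a₂ R ^ b₂ ⋯` given by the list of pairs `(a₁, b₁), (a₂, b₂), …`. -/
def blocks : List (ℕ × ℕ) → Word
  | [] => []
  | p :: l => List.replicate p.1 Letter.L ++ (List.replicate p.2 Letter.R ++ blocks l)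

/-- The sum of the weights of the row-balanced matrices met at the ends of the runs of `blocks l`,
when this word is read from `Y`. -/
noncomputable def cost (n : ℕ) : List (ℕ × ℕ) → Mat → ℕ
  | [], _ => 0
  | p :: l, Y =>
    weight n Letter.R Y + (weight n Letter.L (nf n (Y * mu (List.replicate p.1 Letter.L))) +
      cost n l (nf n (nf n (Y * mu (List.replicate p.1 Letter.L)) *
        mu (List.replicate p.2 Letter.R))))

theorem nf_mul_append {n : ℕ} (hn : 0 < n) {Y : Mat} (hY : Y ∈ D n) (V V' : Word) :
    nf n (Y * mu (V ++ V')) = nf n (nf n (Y * mu V) * mu V') ∧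
      out n (Y * mu (V ++ V')) = out n (Y * mu V) ++ out n (nf n (Y * mu V) * mu V') := by
  have := nf_mul_mu hn ((mul_mu_mem_D n V _).2 hY) V'
  rwa [mul_assoc, ← mu_append] at this

theorem nf_mul_mu_mem {n : ℕ} (hn : 0 < n) {Y : Mat} (hY : Y ∈ D n) (V : Word) :
    nf n (Y * mu V) ∈ RB n :=
  nf_mem hn ((mul_mu_mem_D n V _).2 hY)

theorem out_of_mem_RB {n : ℕ} (hn : 0 < n) {P : Mat} (hP : P ∈ RB n) : out n P = [] :=
  (nf_out_eq hn (W := []) hP (by rw [mu_nil, one_mul])).2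

/-- The output on `blocks l`, counted with its left neighbour `R`, changes letters `cost` many
times, since the output on each run of the input ends with the letter of that run. -/
theorem switches_out_blocks {n : ℕ} (hn : 0 < n) (l : List (ℕ × ℕ))
    (hl : ∀ p ∈ l, 3 * n ≤ p.1 ∧ 3 * n ≤ p.2) {Y : Mat} (hY : Y ∈ RB n) :
    (∃ U, Letter.R :: out n (Y * mu (blocks l)) = U ++ [Letter.R]) ∧
      switches (Letter.R :: out n (Y * mu (blocks l))) = cost n l Y := by
  induction l generalizing Y with
  | nil =>
    rw [blocks, mu_nil, mul_one, out_of_mem_RB hn hY]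
    exact ⟨⟨[], rfl⟩, rfl⟩
  | cons p l ih =>
    obtain ⟨ha, hb⟩ := hl p (by simp)
    have hP := nf_mul_mu_mem hn hY.1 (List.replicate p.1 Letter.L)
    obtain ⟨-, ⟨U₁, h1⟩, h2⟩ := read_run_L hn hY.1 ha
    obtain ⟨-, ⟨U₂, h3⟩, h4⟩ := read_run_R hn hP.1 hb
    obtain ⟨⟨U₃, h5⟩, h6⟩ := ih (fun q hq => hl q (by simp [hq]))
      (nf_mul_mu_mem hn hP.1 (List.replicate p.2 Letter.R))
    rw [blocks, (nf_mul_append hn hY.1 _ _).2, (nf_mul_append hn hP.1 _ _).2, cost]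
    refine ⟨⟨Letter.R :: out n (Y * mu (List.replicate p.1 Letter.L)) ++ U₂ ++ U₃, ?_⟩, ?_⟩
    · rw [List.append_assoc _ U₃, ← h5, h3]
      simp
    · rw [switches_glue _ ⟨Letter.R :: U₁, by rw [h1]; rfl⟩,
        switches_glue _ ⟨Letter.L :: U₂, by rw [h3]; rfl⟩, h2, h4, h6]

theorem L_mem_out_blocks {n : ℕ} (hn : 0 < n) {l : List (ℕ × ℕ)} (hne : l ≠ [])
    (hl : ∀ p ∈ l, 3 * n ≤ p.1 ∧ 3 * n ≤ p.2) {Y : Mat} (hY : Y ∈ D n) :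
    Letter.L ∈ out n (Y * mu (blocks l)) := by
  obtain ⟨p, l, rfl⟩ := List.exists_cons_of_ne_nil hne
  obtain ⟨-, ⟨U, h⟩, -⟩ := read_run_L hn hY (hl p (by simp)).1
  rw [blocks, (nf_mul_append hn hY _ _).2, h]
  simp

theorem nf_blocks_upper {n : ℕ} (hn : 0 < n) {l : List (ℕ × ℕ)} (hne : l ≠ [])
    (hl : ∀ p ∈ l, 3 * n ≤ p.1 ∧ 3 * n ≤ p.2) {Y : Mat} (hY : Y ∈ D n) :
    nf n (Y * mu (blocks l)) 1 0 = 0 := by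
  induction l generalizing Y with
  | nil => exact absurd rfl hne
  | cons p l ih =>
    have hP := (nf_mul_mu_mem hn hY (List.replicate p.1 Letter.L)).1
    have hQ := nf_mul_mu_mem hn hP (List.replicate p.2 Letter.R)
    rw [blocks, (nf_mul_append hn hY _ _).1, (nf_mul_append hn hP _ _).1]
    rcases eq_or_ne l [] with rfl | h
    · rw [blocks, mu_nil, mul_one, nf_of_mem_RB hn hQ]
      exact (read_run_R hn hP (hl p (by simp)).2).1
    · exact ih h (fun q hq => hl q (by simp [hq])) hQ.1

/-- If reading `blocks l` is injective on `T`, then so is reading any prefix of it, and therefore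
the weights that occur at the end of one and the same run belong to different matrices. -/
theorem sum_cost_le {n : ℕ} (hn : 0 < n) (l : List (ℕ × ℕ))
    (hl : ∀ p ∈ l, 3 * n ≤ p.1 ∧ 3 * n ≤ p.2) (T : Finset Mat)
    (hT : ∀ Y ∈ T, Y ∈ RB n ∧ Y 1 0 = 0)
    (hinj : Set.InjOn (fun Y => nf n (Y * mu (blocks l))) T) :
    ∑ Y ∈ T, cost n l Y ≤ l.length * (2 * totalWeight n) := by
  classical
  induction l generalizing T with
  | nil => simp [cost]
  | cons p l ih =>
    obtain ⟨ha, hb⟩ := hl p (by simp)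
    set f := fun Y => nf n (Y * mu (List.replicate p.1 Letter.L)) with hf
    set g := fun Y => nf n (Y * mu (List.replicate p.2 Letter.R)) with hg
    have hfm : ∀ Y ∈ T, f Y ∈ RB n := fun Y hY => nf_mul_mu_mem hn (hT Y hY).1.1 _
    have hcomp : Set.InjOn ((fun Y => nf n (Y * mu (blocks l))) ∘ g ∘ f) T := by
      refine hinj.congr fun Y hY => ?_
      simp only [Function.comp, hf, hg]
      rw [blocks, (nf_mul_append hn (hT Y hY).1.1 _ _).1, (nf_mul_append hn (hfm Y hY).1 _ _).1]
    have hgf : Set.InjOn (g ∘ f) T := Set.InjOn.of_comp hcomp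
    have hfi : Set.InjOn f T := Set.InjOn.of_comp hgf
    have h1 := sum_weight_R_le hn T hT
    have h2 := sum_weight_L_le hn (T.image f) (by
      intro Q hQ
      obtain ⟨Y, hY, rfl⟩ := Finset.mem_image.1 hQ
      exact ⟨hfm Y hY, (read_run_L hn (hT Y hY).1.1 ha).1⟩)
    have h3 := ih (fun q hq => hl q (by simp [hq])) (T.image (g ∘ f)) (by
      intro Q hQ
      obtain ⟨Y, hY, rfl⟩ := Finset.mem_image.1 hQ
      exact ⟨nf_mul_mu_mem hn (hfm Y hY).1 _, (read_run_R hn (hfm Y hY).1 hb).1⟩)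
      (by rw [Finset.coe_image]; exact hcomp.image_of_comp)
    rw [Finset.sum_image hfi] at h2
    rw [Finset.sum_image hgf] at h3
    simp only [cost, Finset.sum_add_distrib, List.length_cons]
    have h4 : ∑ Y ∈ T, cost n l (nf n (nf n (Y * mu (List.replicate p.1 Letter.L)) *
        mu (List.replicate p.2 Letter.R))) ≤ l.length * (2 * totalWeight n) := h3
    have h5 : ∑ Y ∈ T, weight n Letter.L (nf n (Y * mu (List.replicate p.1 Letter.L))) ≤
      totalWeight n := h2
    rw [add_mul]
    omega

theorem wpow_zero (V : Word) : wpow V 0 = [] := rfl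

theorem wpow_succ (V : Word) (k : ℕ) : wpow V (k + 1) = V ++ wpow V k := rfl

theorem wpow_add (V : Word) (j k : ℕ) : wpow V (j + k) = wpow V j ++ wpow V k := by
  rw [wpow, List.replicate_add, List.flatten_append]; rfl

theorem wpow_mul (V : Word) (j k : ℕ) : wpow V (j * k) = wpow (wpow V j) k := by
  induction k with
  | zero => rfl
  | succ k ih => rw [Nat.mul_succ, Nat.add_comm, wpow_add, ih, wpow_succ]

/-- The row-balanced matrix reached from `Y` by reading the word `V`. -/
noncomputable def readWord (n : ℕ) (V : Word) (Y : Mat) : Mat := nf n (Y * mu V)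

theorem readWord_mem {n : ℕ} (hn : 0 < n) (V : Word) {Y : Mat} (hY : Y ∈ RB n) :
    readWord n V Y ∈ RB n := nf_mul_mu_mem hn hY.1 V

theorem readWord_append {n : ℕ} (hn : 0 < n) {Y : Mat} (hY : Y ∈ RB n) (V V' : Word) :
    readWord n (V ++ V') Y = readWord n V' (readWord n V Y) := (nf_mul_append hn hY.1 V V').1

theorem readWord_wpow {n : ℕ} (hn : 0 < n) (V : Word) (k : ℕ) {Y : Mat} (hY : Y ∈ RB n) :
    readWord n (wpow V k) Y = (readWord n V)^[k] Y := by
  induction k generalizing Y with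
  | zero => rw [wpow_zero, readWord, mu_nil, mul_one, nf_of_mem_RB hn hY]; rfl
  | succ k ih =>
    rw [wpow_succ, readWord_append hn hY, ih (readWord_mem hn V hY), Function.iterate_succ_apply]

theorem switches_out_wpow {n : ℕ} (hn : 0 < n) (l : List (ℕ × ℕ))
    (hl : ∀ p ∈ l, 3 * n ≤ p.1 ∧ 3 * n ≤ p.2) (k : ℕ) {Y : Mat} (hY : Y ∈ RB n) :
    (∃ U, Letter.R :: out n (Y * mu (wpow (blocks l) k)) = U ++ [Letter.R]) ∧
    switches (Letter.R :: out n (Y * mu (wpow (blocks l) k))) =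
      ∑ r ∈ Finset.range k, cost n l ((readWord n (blocks l))^[r] Y) := by
  induction k generalizing Y with
  | zero =>
    rw [wpow_zero, mu_nil, mul_one, out_of_mem_RB hn hY]
    exact ⟨⟨[], rfl⟩, rfl⟩
  | succ k ih =>
    obtain ⟨⟨U, h1⟩, h2⟩ := switches_out_blocks hn l hl hY
    obtain ⟨⟨U', h3⟩, h4⟩ := ih (readWord_mem hn (blocks l) hY)
    rw [wpow_succ, (nf_mul_append hn hY.1 _ _).2, Finset.sum_range_succ', switches_glue _ ⟨U, h1⟩,
      h2, add_comm]
    refine ⟨⟨U ++ U', ?_⟩, congrArg₂ _ h4 rfl⟩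
    rw [← List.cons_append, h1, List.append_assoc, List.append_assoc, List.singleton_append]
    exact congrArg _ h3

/-- Start the cyclic word `W` at its first `L`. -/
theorem sigmaC_le_switches {W : Word} (h : ∃ U, Letter.R :: W = U ++ [Letter.R])
    (hL : Letter.L ∈ W) : sigmaC W ≤ switches (Letter.R :: W) := by
  obtain ⟨A, T, rfl, hA⟩ := List.eq_append_cons_of_mem hL
  obtain ⟨m, rfl⟩ : ∃ m, A = List.replicate m Letter.R := by
    refine ⟨A.length, List.eq_replicate_of_mem fun b hb => ?_⟩
    cases b
    · exact absurd hb hA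
    · rfl
  obtain ⟨T', hT'⟩ : ∃ T', Letter.L :: T = T' ++ [Letter.R] := by
    obtain ⟨T', z, hz⟩ := (List.eq_nil_or_concat (Letter.L :: T)).resolve_left (by simp)
    rw [List.concat_eq_append] at hz
    obtain ⟨U, hU⟩ := h
    rw [hz, ← List.append_assoc, ← List.cons_append] at hU
    have := (List.append_inj' hU rfl).2
    exact ⟨T', by rw [hz, this]⟩
  have h1 : switches (Letter.R :: (List.replicate m Letter.R ++ Letter.L :: T)) =
      1 + switches (Letter.L :: T) := by
    rw [← List.cons_append, ← List.replicate_succ, switches_replicate_append,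
      switches_cons_cons]
    simp
  have h2 : sigma (Letter.L :: T ++ List.replicate m Letter.R) = 1 + switches (Letter.L :: T) := by
    rw [sigma_of_ne_nil (by simp), hT', switches_append_replicate, add_comm]
  rw [h1, ← h2]
  exact Nat.sInf_le ⟨_, ⟨_, _, rfl, rfl⟩, rfl⟩

/-- The estimate for a closed path of row-balanced matrices that starts at the beginning of a run
of `L`s. -/
theorem sigmaC_out_le {n : ℕ} (hn : 0 < n) {l : List (ℕ × ℕ)} (hne : l ≠ [])
    (hl : ∀ p ∈ l, 3 * n ≤ p.1 ∧ 3 * n ≤ p.2) {Y : Mat} (hY : Y ∈ RB n) {δ : ℕ} (hδ : 0 < δ)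
    (hper : Function.minimalPeriod (readWord n (blocks l)) Y = δ) :
    sigmaC (out n (Y * mu (wpow (blocks l) δ))) ≤ l.length * (2 * totalWeight n) := by
  classical
  set F := readWord n (blocks l) with hF
  have hiter : ∀ r, F^[r] Y ∈ RB n := by
    intro r
    rw [← readWord_wpow hn _ r hY]
    exact readWord_mem hn _ hY
  have hret : ∀ r, F^[δ] (F^[r] Y) = F^[r] Y := by
    intro r
    have := (Function.isPeriodicPt_minimalPeriod F Y).apply_iterate r
    rwa [hper] at this
  obtain ⟨ε, rfl⟩ : ∃ ε, δ = ε + 1 := ⟨δ - 1, by omega⟩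
  obtain ⟨h1, h2⟩ := switches_out_wpow hn l hl (ε + 1) hY
  have hL : Letter.L ∈ out n (Y * mu (wpow (blocks l) (ε + 1))) := by
    rw [wpow_succ, (nf_mul_append hn hY.1 _ _).2]
    exact List.mem_append_left _ (L_mem_out_blocks hn hne hl hY.1)
  refine (sigmaC_le_switches h1 hL).trans ?_
  have hinj : Set.InjOn (fun r => F^[r] Y) (Finset.range (ε + 1)) := by
    intro r hr s hs h
    rw [Finset.mem_coe, Finset.mem_range] at hr hs
    exact Function.iterate_injOn_Iio_minimalPeriod (f := F) (x := Y) (by rw [hper]; exact hr)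
      (by rw [hper]; exact hs) h
  rw [h2, ← Finset.sum_image (f := cost n l) hinj]
  refine sum_cost_le hn l hl _ ?_ ?_
  · intro Q hQ
    obtain ⟨r, -, rfl⟩ := Finset.mem_image.1 hQ
    refine ⟨hiter r, ?_⟩
    rw [← hret r, Function.iterate_succ_apply', ← Function.iterate_add_apply]
    exact nf_blocks_upper hn hne hl (hiter _).1
  -- on the cycle, the `ε`-th iterate inverts the reading of one copy of the word
  · intro Q hQ Q' hQ' h
    obtain ⟨r, -, rfl⟩ := Finset.mem_image.1 (Finset.mem_coe.1 hQ)
    obtain ⟨s, -, rfl⟩ := Finset.mem_image.1 (Finset.mem_coe.1 hQ')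
    rw [← hret r, ← hret s]
    rw [Function.iterate_succ_apply, Function.iterate_succ_apply]
    exact congrArg F^[ε] h

/-! ### Rotation of closed paths -/

theorem mem_tau_iff {V W : Word} : W ∈ tau V ↔ V ~r W := by
  constructor
  · rintro ⟨V₁, V₂, rfl, rfl⟩
    exact List.isRotated_append
  · rintro ⟨k, rfl⟩
    exact ⟨_, _, (List.take_append_drop (k % V.length) V).symm,
      List.rotate_eq_drop_append_take_mod⟩

theorem sigmaC_congr {V W : Word} (h : V ~r W) : sigmaC V = sigmaC W := by
  have : tau V = tau W := by
    ext U
    rw [mem_tau_iff, mem_tau_iff]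
    exact ⟨fun h' => h.symm.trans h', fun h' => h.trans h'⟩
  rw [sigmaC, sigmaC, this]

theorem wpow_rotate (u v : Word) (k : ℕ) : u ++ wpow (v ++ u) k = wpow (u ++ v) k ++ u := by
  induction k with
  | zero => simp [wpow_zero]
  | succ k ih =>
    rw [wpow_succ, wpow_succ, List.append_assoc, List.append_assoc, List.append_assoc, ← ih]

theorem iterate_readWord_rotate {n : ℕ} (hn : 0 < n) (u v : Word) (k : ℕ) {M : Mat}
    (hM : M ∈ RB n) :
    (readWord n (v ++ u))^[k] (readWord n u M) = readWord n u ((readWord n (u ++ v))^[k] M) := by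
  rw [← readWord_wpow hn _ k (readWord_mem hn u hM), ← readWord_append hn hM, wpow_rotate,
    readWord_append hn hM, readWord_wpow hn _ k hM]

theorem minimalPeriod_rotate {n : ℕ} (hn : 0 < n) (u v : Word) {M : Mat} (hM : M ∈ RB n)
    (hper : M ∈ Function.periodicPts (readWord n (u ++ v))) :
    Function.minimalPeriod (readWord n (v ++ u)) (readWord n u M) =
      Function.minimalPeriod (readWord n (u ++ v)) M := by
  have hiter : ∀ k, (readWord n (u ++ v))^[k] M ∈ RB n := by
    intro k
    rw [← readWord_wpow hn _ k hM]
    exact readWord_mem hn _ hM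
  apply Nat.dvd_antisymm
  · apply Function.IsPeriodicPt.minimalPeriod_dvd
    rw [Function.IsPeriodicPt, Function.IsFixedPt, iterate_readWord_rotate hn u v _ hM,
      Function.isPeriodicPt_minimalPeriod]
  · rw [← Function.minimalPeriod_apply hper]
    apply Function.IsPeriodicPt.minimalPeriod_dvd
    have h := Function.isPeriodicPt_minimalPeriod (readWord n (v ++ u)) (readWord n u M)
    generalize Function.minimalPeriod (readWord n (v ++ u)) (readWord n u M) = k at h ⊢
    rw [Function.IsPeriodicPt, Function.IsFixedPt, iterate_readWord_rotate hn u v _ hM] at h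
    have h' := congrArg (readWord n v) h
    rw [← readWord_append hn (hiter k), ← readWord_append hn hM] at h'
    rw [Function.IsPeriodicPt, Function.IsFixedPt, ← Function.iterate_succ_apply,
      Function.iterate_succ_apply']
    exact h'

/-- Conjugating the input of a closed path conjugates its output. -/
theorem out_rotate {n : ℕ} (hn : 0 < n) (u v : Word) {M : Mat} (hM : M ∈ RB n) {δ : ℕ}
    (hδ : 0 < δ) (hper : Function.IsPeriodicPt (readWord n (u ++ v)) δ M) :
    out n (M * mu (wpow (u ++ v) δ)) ~r
      out n (readWord n u M * mu (wpow (v ++ u) δ)) := by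
  obtain ⟨ε, rfl⟩ : ∃ ε, δ = ε + 1 := ⟨δ - 1, by omega⟩
  have h1 := (nf_mul_append hn hM.1 u (wpow (v ++ u) (ε + 1))).2
  rw [wpow_rotate, (nf_mul_append hn hM.1 _ _).2] at h1
  have hret : nf n (M * mu (wpow (u ++ v) (ε + 1))) = M :=
    (readWord_wpow hn (u ++ v) (ε + 1) hM).trans hper
  have h2 := (nf_mul_append hn hM.1 u (v ++ wpow (u ++ v) ε)).2
  rw [← List.append_assoc, ← wpow_succ] at h2
  rw [hret, h2, List.append_assoc] at h1
  rw [h2, readWord, ← List.append_cancel_left h1]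
  exact List.isRotated_append

/-- A closed walk that is not a power of a shorter closed walk runs once around its cycle. -/
theorem minimalPeriod_of_walk {n : ℕ} (hn : 0 < n) {M : Mat} {V : Word} {δ : ℕ} {C : List Edge}
    (hδ : 0 < δ) (hC : IsWalk n M C M) (hin : inputWord C = wpow V δ)
    (hprim : ∀ (m₁ δ₁ : ℕ) (C₁ : List Edge), 2 ≤ m₁ → 0 < δ₁ →
        IsWalk n M C₁ M → inputWord C₁ = wpow V δ₁ → C ≠ (List.replicate m₁ C₁).flatten) :
    Function.minimalPeriod (readWord n V) M = δ := by
  have hM := isWalk_src hC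
  have heq := isWalk_mul_mu hC
  rw [hin] at heq
  have hper : Function.IsPeriodicPt (readWord n V) δ M := by
    rw [Function.IsPeriodicPt, Function.IsFixedPt, ← readWord_wpow hn V δ hM.1]
    exact (nf_out_eq hn hM.1 heq).1
  have hpos := hper.minimalPeriod_pos hδ
  have hp := Function.isPeriodicPt_minimalPeriod (readWord n V) M
  obtain ⟨q, hq⟩ := hper.minimalPeriod_dvd
  generalize Function.minimalPeriod (readWord n V) M = p at *
  by_contra hne
  have hq2 : 2 ≤ q := by
    rcases q with - | - | q
    · omega
    · omega
    · omega
  rw [Function.IsPeriodicPt, Function.IsFixedPt, ← readWord_wpow hn V p hM.1] at hp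
  obtain ⟨C₁, hC₁, hin₁, -⟩ : Walk n M (wpow V p) (out n (M * mu (wpow V p))) M := by
    refine (walk_iff hn).2 ⟨hM, hM, ?_⟩
    have := (nf_out_spec hn ((mul_mu_mem_D n (wpow V p) _).2 hM.1.1)).2
    rwa [show nf n (M * mu (wpow V p)) = M from hp] at this
  refine hprim q p C₁ hq2 hpos hC₁ hin₁ ?_
  have hpow : ∀ k, IsWalk n M (List.replicate k C₁).flatten M ∧
      inputWord (List.replicate k C₁).flatten = wpow (wpow V p) k := by
    intro k
    induction k with
    | zero => exact ⟨⟨hM, rfl⟩, rfl⟩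
    | succ k ih =>
      rw [List.replicate_succ, List.flatten_cons]
      refine ⟨isWalk_append hC₁ ih.1, ?_⟩
      rw [wpow_succ, ← ih.2, ← hin₁, inputWord, List.map_append, List.flatten_append]
      rfl
  refine isWalk_unique hn hC (hpow q).1 ?_
  rw [(hpow q).2, hin, ← wpow_mul, ← hq]

/-! ### Words with long runs -/

/-- The word with run lengths `m₁, m₂, …` whose first run consists of the letter `Z`. -/
def alternating : Letter → List ℕ → Word
  | _, [] => []
  | Z, m :: ms => List.replicate m Z ++ alternating Z.swap ms

theorem alternating_append_singleton (Z : Letter) (ms : List ℕ) (m : ℕ) :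
    alternating Z (ms ++ [m]) =
      alternating Z ms ++ List.replicate m (if Even ms.length then Z else Z.swap) := by
  induction ms generalizing Z with
  | nil => simp [alternating]
  | cons k ms ih =>
    rw [List.cons_append, alternating, ih, alternating, List.append_assoc, Letter.swap_swap,
      List.length_cons]
    by_cases h : Even ms.length <;> simp [h, Nat.even_add_one]

theorem exists_blocks_of_alternating_L (ms : List ℕ) (h : Even ms.length) :
    ∃ l, alternating Letter.L ms = blocks l ∧ 2 * l.length = ms.length ∧
      ∀ p ∈ l, p.1 ∈ ms ∧ p.2 ∈ ms := by
  match ms, h with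
  | [], _ => exact ⟨[], rfl, rfl, by simp⟩
  | [m], h => simp at h
  | a :: b :: ms, h =>
    obtain ⟨l, h1, h2, h3⟩ := exists_blocks_of_alternating_L ms (by
      simpa [Nat.even_add_one] using h)
    refine ⟨(a, b) :: l, ?_, by simp; omega, ?_⟩
    · rw [blocks, ← h1]; rfl
    · intro p hp
      rcases List.mem_cons.1 hp with rfl | hp
      · simp
      · have := h3 p hp
        simp [this]

theorem exists_blocks_of_alternating (Z : Letter) (ms : List ℕ) (h : Even ms.length) :
    ∃ l, alternating Z ms ~r blocks l ∧ 2 * l.length = ms.length ∧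
      ∀ p ∈ l, p.1 ∈ ms ∧ p.2 ∈ ms := by
  cases Z with
  | L =>
    obtain ⟨l, h1, h2, h3⟩ := exists_blocks_of_alternating_L ms h
    exact ⟨l, by rw [h1], h2, h3⟩
  | R =>
    cases ms with
    | nil => exact ⟨[], List.IsRotated.refl _, rfl, by simp⟩
    | cons m ms =>
      rw [List.length_cons, Nat.even_add_one] at h
      obtain ⟨l, h1, h2, h3⟩ := exists_blocks_of_alternating_L (ms ++ [m]) (by
        simpa [Nat.even_add_one] using h)
      refine ⟨l, ?_, by rw [h2]; simp, fun p hp => by simpa [or_comm] using h3 p hp⟩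
      rw [← h1, alternating_append_singleton, if_neg h]
      exact List.isRotated_append

/-- `κ` turns a word into one with the same number of runs, all of them long. -/
theorem kappaRun_flatten (n : ℕ) (rs : List Word) (h0 : [] ∉ rs)
    (h1 : ∀ r ∈ rs, r.IsChain fun x y => decide (x = y))
    (h2 : rs.IsChain fun r r' => ∃ ha hb, decide (r.getLast ha = r'.head hb) = false) :
    ∃ Z ms, (rs.map (kappaRun n)).flatten = alternating Z ms ∧ ms.length = rs.length ∧
      (∀ m ∈ ms, 4 * n ≤ m) ∧ ∀ r ∈ rs.head?, r.head? = some Z := by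
  induction rs with
  | nil => exact ⟨Letter.L, [], rfl, rfl, by simp, by simp⟩
  | cons r rs ih =>
    obtain ⟨Z, ms, h3, h4, h5, h6⟩ := ih (fun h => h0 (by simp [h]))
      (fun r hr => h1 r (by simp [hr])) h2.tail
    obtain ⟨x, t, rfl⟩ := List.exists_cons_of_ne_nil (l := r) (by rintro rfl; simp at h0)
    have hx : ∀ y ∈ x :: t, y = x := by
      have hc : (x :: t).IsChain (· = ·) := by simpa using h1 (x :: t) (by simp)
      intro y hy
      rcases List.mem_cons.1 hy with rfl | hy
      · rfl
      · rw [List.isChain_cons_eq_iff_eq_replicate.1 hc] at hy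
        exact (List.mem_replicate.1 hy).2
    refine ⟨x, (4 * n + (t.length + 1) % n) :: ms, ?_, by simp [h4], ?_, by simp⟩
    · rw [List.map_cons, List.flatten_cons, h3, kappaRun, alternating]
      cases rs with
      | nil =>
        obtain rfl : ms = [] := by simpa using h4
        rfl
      | cons r' rs =>
        have hr' := h6 r' (by simp)
        obtain ⟨ha, hb, hne⟩ := (List.isChain_cons_cons.1 h2).1
        rw [List.head?_eq_some_head hb, Option.some.injEq] at hr'
        rw [hx _ (List.getLast_mem ha), hr', decide_eq_false_iff_not] at hne
        rw [← Letter.eq_swap_of_ne hne]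
    · intro m hm
      rcases List.mem_cons.1 hm with rfl | hm
      · omega
      · exact h5 m hm

theorem exists_alternating_kappa (n : ℕ) (W : Word) :
    ∃ Z ms, kappa n W = alternating Z ms ∧ ms.length = sigma W ∧ ∀ m ∈ ms, 4 * n ≤ m := by
  obtain ⟨Z, ms, h1, h2, h3, -⟩ := kappaRun_flatten n (runs W) (List.nil_notMem_splitBy _ _)
    (fun r hr => List.isChain_of_mem_splitBy hr)
    (List.isChain_getLast_head_splitBy (fun x y => decide (x = y)) W)
  exact ⟨Z, ms, h1, h2, h3⟩

/-- A primitive word `V ∈ τ_κ(V)` is conjugate to a word with an even number of long runs, at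
most `σ_c(V)` many. If the number of runs of `κ(W')` is odd, then the last run is merged with the
first one. -/
theorem exists_blocks_of_mem_tauKappa {n : ℕ} (hn : 0 < n) {V : Word} (hV : Primitive V)
    (h : V ∈ tauKappa n V) :
    ∃ l, V ~r blocks l ∧ l ≠ [] ∧ 2 * l.length ≤ sigmaC V ∧
      ∀ p ∈ l, 4 * n ≤ p.1 ∧ 4 * n ≤ p.2 := by
  obtain ⟨W, -, hσ, hVW⟩ := h
  rw [mem_tau_iff] at hVW
  obtain ⟨Z, ms, h1, h2, h3⟩ := exists_alternating_kappa n W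
  rw [h1] at hVW
  rw [hσ] at h2
  have hone : ∀ (Y : Letter) (m : ℕ), V = List.replicate m Y → m = 1 := by
    intro Y m hm
    refine hV [Y] m ?_
    rw [hm, wpow, List.flatten_replicate_singleton]
  have hne : V ≠ [] := fun h0 => by simpa using hone Letter.L 0 h0
  have key : ∀ ms' : List ℕ, Even ms'.length → ms'.length ≤ ms.length →
      (∀ m ∈ ms', 4 * n ≤ m) → alternating Z ms' ~r V → ∃ l, V ~r blocks l ∧ l ≠ [] ∧
        2 * l.length ≤ sigmaC V ∧ ∀ p ∈ l, 4 * n ≤ p.1 ∧ 4 * n ≤ p.2 := by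
    intro ms' he hle hms' hrot
    obtain ⟨l, h4, h5, h6⟩ := exists_blocks_of_alternating Z ms' he
    refine ⟨l, hrot.symm.trans h4, ?_, by omega, fun p hp =>
      ⟨hms' _ (h6 p hp).1, hms' _ (h6 p hp).2⟩⟩
    rintro rfl
    exact hne (List.isRotated_nil_iff.1 (hrot.symm.trans h4))
  rcases Nat.even_or_odd ms.length with he | ho
  · exact key ms he le_rfl h3 hVW
  · obtain ⟨m, ms, rfl⟩ := List.exists_cons_of_ne_nil (l := ms) (by rintro rfl; simp at ho)
    rcases List.eq_nil_or_concat ms with rfl | ⟨mid, m', rfl⟩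
    · rw [alternating, alternating, List.append_nil] at hVW
      have := h3 m (by simp)
      obtain ⟨k, hk⟩ := hVW
      have := hone Z m (by rw [← hk, List.rotate_replicate])
      omega
    · rw [List.concat_eq_append] at *
      have hmid : ¬ Even mid.length := by
        simpa [Nat.even_add_one, Nat.odd_add_one] using ho
      refine key ((m' + m) :: mid) (by simpa [Nat.even_add_one] using hmid) (by simp) ?_ ?_
      · intro k hk
        rcases List.mem_cons.1 hk with rfl | hk
        · have := h3 m (by simp)
          omega
        · exact h3 k (by simp [hk])
      · refine List.IsRotated.trans ?_ hVW
        rw [alternating, alternating, alternating_append_singleton, if_neg hmid, Letter.swap_swap,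
          List.replicate_add, List.append_assoc (List.replicate m' Z),
          ← List.append_assoc (List.replicate m Z)]
        exact List.isRotated_append

end Raney

/-! ### The estimate -/

theorem mainTheorem4 (n : ℕ) (hn : 0 < n) :
    -- the words `W_{L,M,i}` are well defined
    (∀ M ∈ Raney.LE n, ∀ i ∈ Finset.Ico (Raney.nuL n M) (2 * Raney.nuL n M),
      ∃! t : Raney.Mat × ℕ × Raney.Word, Raney.IsLRData n M i t.1 t.2.1 t.2.2) ∧
    -- the estimate
    ∀ (M : Raney.Mat) (V₀ : Raney.Word) (δ : ℕ) (C : List Raney.Edge),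
      0 < δ →
      Raney.Primitive V₀ →
      V₀ ∈ Raney.tauKappa n V₀ →
      Raney.IsWalk n M C M →
      Raney.inputWord C = Raney.wpow V₀ δ →
      (∀ (m₁ δ₁ : ℕ) (C₁ : List Raney.Edge), 2 ≤ m₁ → 0 < δ₁ →
        Raney.IsWalk n M C₁ M → Raney.inputWord C₁ = Raney.wpow V₀ δ₁ →
        C ≠ (List.replicate m₁ C₁).flatten) →
      (Raney.sigmaC (Raney.outputWord C) : ℤ) ≤
        (Raney.sigmaC V₀ : ℤ) *
          ∑ N ∈ (Raney.LE_finite n).toFinset,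
            ∑ i ∈ Finset.Ico (Raney.nuL n N) (2 * Raney.nuL n N),
              ((Raney.sigma (Raney.wordL n N i) : ℤ) - 1) := by
  refine ⟨fun M hM i _ => Raney.existsUnique_isLRData hn hM i, ?_⟩
  intro M V₀ δ C hδ hV hκ hC hin hprim
  rw [← Raney.totalWeight_cast hn]
  have hM := (Raney.isWalk_src hC).1
  have hper := Raney.minimalPeriod_of_walk hn hδ hC hin hprim
  have hper' : Function.IsPeriodicPt (Raney.readWord n V₀) δ M :=
    hper ▸ Function.isPeriodicPt_minimalPeriod _ _
  have hout : Raney.out n (M * Raney.mu (Raney.wpow V₀ δ)) = Raney.outputWord C := by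
    rw [← hin]
    exact (Raney.nf_out_eq hn hM (Raney.isWalk_mul_mu hC)).2
  obtain ⟨l, hrot, hne, hlen, hl⟩ := Raney.exists_blocks_of_mem_tauKappa hn hV hκ
  obtain ⟨u, v, rfl, hvu⟩ := Raney.mem_tau_iff.2 hrot
  have h := Raney.sigmaC_out_le hn hne
    (fun p hp => ⟨by have := (hl p hp).1; omega, by have := (hl p hp).2; omega⟩)
    (Raney.readWord_mem hn u hM) hδ
    (by rw [hvu, Raney.minimalPeriod_rotate hn u v hM ⟨δ, hδ, hper'⟩, hper])
  rw [hvu, ← Raney.sigmaC_congr (Raney.out_rotate hn u v hM hδ hper'), hout] at h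
  have h2 : l.length * (2 * Raney.totalWeight n) ≤
      Raney.sigmaC (u ++ v) * Raney.totalWeight n := by
    rw [← mul_assoc, mul_comm l.length 2]
    exact Nat.mul_le_mul_right _ hlen
  exact_mod_cast h.trans h2
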